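/- **Conventions.** Let $\Bbbk$ be a field, $\mathsf C$ a small category, and $\mathcal A:\mathsf C\to\mathsf{Alg}_\Bbbk$ a functor to associative, not necessarily unital, $\Bbbk$-algebras (a diagram of algebras). Let $$C^{p,q}=\prod_{x_0\leftarrow\dots\leftarrow x_p}\operatorname{Hom}_\Bbbk\big(\mathcal A(x_p)^{\otimes q},\mathcal A(x_0)\big),$$ the product over the $p$-simplices of the nerve of $\mathsf C$, with shifted total degree $|f|=p+q-1$ for $f\in C^{p,q}$, and $[p]=\{0,\dots,p\}$. The normalized asimplicial subcomplex $\bar C_{\mathrm a}^{\bullet,\bullet}$ consists of the cochains with components only in bidegrees $q\ge 1$ that vanish on each simplex one of whose arrows is an identity. Let $\hat{\mathsf m}\in C^{0,2}$ be the multiplication, $\hat{\mathsf m}[x](a,b)=ab$. *Quilts.* A quilt $Q=(W,T)$ of arity $n\ge1$ and degree $d$ is a planar rooted tree $T$ on the vertices $1,\dots,n$ (with ancestor order $<$, where ancestors are smaller, and left-of order $\vartriangleleft$) and a word $W$ of length $n+d$ in these vertices, in which each vertex occurs, no two consecutive letters are equal and no subsequence $uvuv$ with $u\ne v$ occurs,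 such that $W=\dots u\dots v\dots$ implies $u\not> v$, and $W=\dots u\dots v\dots u\dots$ with $v\neq u$ implies $v\vartriangleleft u$. A vertex $v$ is interposed if $W=\dots uv\dots u\dots$ with $uv$ adjacent. The order of first occurrence of the vertices in $W$ is called the $\downarrow$ order. *Action.* For $f_a\in C^{p_a,q_a}$ put $p'=\sum p_a-d$, $q'=1+\sum(q_a-1)$. A coloring $(\zeta,I)$ of $Q$ consists of: strictly increasing maps $\zeta_a:[p_a]\to[p']$ whose images cover $[p']$ and for which there are maps $\pi_a$ from $[p_a]$ onto the set of occurrences of $a$ in $W$ such that each set $\zeta_a(\pi_a^{-1}(\underline a))$ is an interval, and its maximum is the minimum of the interval of the next letter of $W$; and a labelling of each edge $(u,v)$ of $T$ by a number $1\le I_{(u,v)}\le q_u$, increasing from left to right on the children of $u$. The cochain $\mathcal L(\zeta,I;f_1,\dots,f_n)\in C^{p',q'}$ is obtained, on $x_0\leftarrow\dots\leftarrow x_{p'}$, by inserting, for each edge $(u,v)$, the value of $f_v[\zeta_v^*(x_0\leftarrow\dots\leftarrow x_{p'})]$ as input number $I_{(u,v)}$ of $f_u[\zeta_u^*(x_0\leftarrow\dots\leftarrow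 x_{p'})]$, the maps of $\mathcal A$ being used to pass between the algebras $\mathcal A(x_i)$, including from $\mathcal A(x_{p'})$ to the free inputs and from the root to $\mathcal A(x_0)$. Then $$\widehat Q(f_1,\dots,f_n)=\sum_{(\zeta,I)}\operatorname{sgn}_Q(\zeta,I)\,\mathcal L(\zeta,I;f_1,\dots,f_n).$$ Here $\operatorname{sgn}_Q(\zeta,I)$ is the sign of the permutation from the word that lists, for $a=1,\dots,n$, the letters $0_{\mathrm va},\dots,(p_a-1)_{\mathrm va},1_{\mathrm ha},\dots,(q_a-1)_{\mathrm ha}$, to the word consisting of: the letters $0_{\mathrm va}$ of the interposed $a$ in reverse $\downarrow$ order; then the other letters $i_{\mathrm va}$, ordered by $\zeta_a(i)$; then the letters $j_{\mathrm ha}$ in left-to-right order in the colored tree, where $j_{\mathrm ha}$ stands before the subtree at a child $b$ of $a$ if and only if $j<I_{(a,b)}$. (If $q_a=0$, replace $q_a$ by $2$; if $a$ is interposed and $p_a=0$, replace $p_a$ by $2$, replace the one-element image $\{m\}$ of $\zeta_a$ by $\{m,m+1,m+2\}$, and raise by $2$ all values of $\zeta$ that belong to later letters of $W$.) Extend $\widehat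 Q$ multilinearly to sums of cochains of different bidegrees. *Coboundary and $P_n$.* The coboundary is $\delta=\delta^{\mathrm S}+\delta^{\mathrm H}$. Here $\delta^{\mathrm S}$ is the alternating sum over the faces of simplices (using the maps of $\mathcal A$ at the two outer faces), and $\delta^{\mathrm H}f=\widehat Q_{12}(\hat{\mathsf m},f)-\widehat Q_{21}(\hat{\mathsf m},f)$, where $Q_{uv}$ has the word $uv$ and the tree with root $u$ and child $v$. Let $\widehat P{}^0_n$ be $(-1)^{1+n(n-1)/2}$ times the sum of $\widehat Q$ over all quilts $Q$ of arity $n$ and degree $n-2$ that are labelled in $\downarrow$ order, and let $\widehat P_n(f_1,\dots,f_n)=\widehat P{}^0_n(f_1,\dots,f_n)+\widehat P{}^0_{n+1}(\hat{\mathsf m},f_1,\dots,f_n)$. **Theorem.** Consider the elements $F=f+g$ of shifted total degree $1$ of $\bar C_{\mathrm a}^{\bullet,\bullet}$, where $f\in C^{0,2}$, and $g\in C^{1,1}$ vanishes on identity morphisms. The solutions $F$ of the Maurer–Cartan equation $$\delta F+\sum_{n=2}^\infty\widehat P_n(F,\dots,F)=0$$ (in which only finitely many terms are required to be nonzero) are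 in bijection with the deformations of $\mathcal A$ as a diagram of algebras, i.e. with the structures of a diagram of associative algebras on the vector spaces $\mathcal A(x)$: an associative bilinear multiplication on each $\mathcal A(x)$ and, for each morphism $\phi:x\to y$ of $\mathsf C$, a linear map $\mathcal A(x)\to\mathcal A(y)$ that is a homomorphism for these multiplications, compatibly with identities and composition. The bijection takes $F=f+g$ to the multiplications $\hat{\mathsf m}[x]+f[x]$ and the maps $\mathcal A[\phi]+g[\phi]$. -/

import Mathlib

open CategoryTheory

namespace HochschildMC

universe t u v w

/-! ### The category of associative, not necessarily unital, algebras -/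

/-- An associative, not necessarily unital, algebra over the field `k`. -/
structure NUAlg (k : Type t) [Field k] : Type (max t (w + 1)) where
  carrier : Type w
  [ring : NonUnitalRing carrier]
  [module : Module k carrier]
  [scalarTower : IsScalarTower k carrier carrier]
  [smulComm : SMulCommClass k carrier carrier]

instance (k : Type t) [Field k] : CoeSort (NUAlg.{t, w} k) (Type w) := ⟨NUAlg.carrier⟩

attribute [instance] NUAlg.ring NUAlg.module NUAlg.scalarTower NUAlg.smulComm

instance (k : Type t) [Field k] : Category.{w} (NUAlg.{t, w} k) where
  Hom X Y := X →ₙₐ[k] Y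
  id X := NonUnitalAlgHom.id k X
  comp f g := NonUnitalAlgHom.comp g f

/-! ### Trees, words and quilts

The vertices of a tree of arity `n`, which are the letters of a word of arity `n`, are the elements
of `Fin n`; thus the labels `1, …, n` become `0, …, n - 1`. -/

/-- A planar rooted tree with vertex set `Fin n`. `edge x y` means that `x` is the parent of `y`,
and `left` is the strict planar ("left of") order. The order generated by `edge` is the reflexive
transitive closure of `edge`; it has the root as its least element. -/
@[ext]
structure PlanarTree (n : ℕ) where
  edge : Fin n → Fin n → Prop
  left : Fin n → Fin n → Prop
  edge_irrefl : ∀ x, ¬ edge x x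
  le_antisymm : ∀ x y, Relation.ReflTransGen edge x y → Relation.ReflTransGen edge y x → x = y
  existsUnique_root : ∃! r, ∀ x, Relation.ReflTransGen edge x r → x = r
  edge_covers : ∀ x y, edge x y → ¬ ∃ z, (Relation.ReflTransGen edge x z ∧ x ≠ z) ∧
    (Relation.ReflTransGen edge z y ∧ z ≠ y)
  left_irrefl : ∀ x, ¬ left x x
  left_trans : ∀ x y z, left x y → left y z → left x z
  left_comparable_iff : ∀ x y, x ≠ y → ((left x y ∨ left y x) ↔
    ¬ (Relation.ReflTransGen edge x y ∨ Relation.ReflTransGen edge y x))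
  left_inherit : ∀ x y x' y', left x y → Relation.ReflTransGen edge x x' →
    Relation.ReflTransGen edge y y' → left x' y'

namespace PlanarTree

variable {n : ℕ} (T : PlanarTree n)

/-- `T.le x y`: the vertex `y` is `x` or a descendant of `x`. -/
def le (x y : Fin n) : Prop := Relation.ReflTransGen T.edge x y

/-- The root of a tree, i.e. its unique minimal vertex. -/
noncomputable def root : Fin n := T.existsUnique_root.choose

/-- The type of edges of a tree. -/
def Edge : Type := {e : Fin n × Fin n // T.edge e.1 e.2}

instance : Finite T.Edge := inferInstanceAs (Finite {e : Fin n × Fin n // T.edge e.1 e.2})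

noncomputable instance : Fintype T.Edge := Fintype.ofFinite _

instance : Finite (PlanarTree n) :=
  Finite.of_injective (fun T : PlanarTree n => (T.edge, T.left)) (by
    intro S T h
    exact PlanarTree.ext (congrArg Prod.fst h) (congrArg Prod.snd h))

end PlanarTree

/-- The words of arity `n`: the words in the alphabet `Fin n` that contain each letter, have no two
equal consecutive letters, and are not interlaced (not of the form `… x … y … x … y …` with
`x ≠ y`). Such a word of length `n + d` has degree `d`. -/
structure IsWord {n L : ℕ} (W : Fin L → Fin n) : Prop where
  surjective : Function.Surjective W
  nondegenerate : ∀ i j : Fin L, (j : ℕ) = i + 1 → W i ≠ W j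
  not_interlaced : ∀ i j k l : Fin L, i < j → j < k → k < l → W i = W k → W j = W l → W i = W j

/-- `x` is interposed in `W`, i.e. `W = … y x … y …`. -/
def Interposed {n L : ℕ} (W : Fin L → Fin n) (x : Fin n) : Prop :=
  ∃ i j k : Fin L, (j : ℕ) = i + 1 ∧ j < k ∧ W j = x ∧ W i = W k

/-- The first occurrence of `x` in `W` is before the first occurrence of `y`. -/
def FirstBefore {n L : ℕ} (W : Fin L → Fin n) (x y : Fin n) : Prop :=
  ∃ i : Fin L, W i = x ∧ ∀ j : Fin L, j ≤ i → W j ≠ y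

/-- A quilt of arity `n` and degree `d`: a word of length `n + d` and a planar rooted tree, with
the same vertices, such that
* if `W = … x … y …`, then `y` is not a proper ancestor of `x`;
* if `W = … x … y … x …` and `y ≠ x`, then `y` is to the left of `x`. -/
@[ext]
structure Quilt (n d : ℕ) where
  word : Fin (n + d) → Fin n
  tree : PlanarTree n
  isWord : IsWord word
  not_lt : ∀ i j, i < j → ¬ (tree.le (word j) (word i) ∧ word j ≠ word i)
  left_of : ∀ i j k, i < j → j < k → word i = word k →
    tree.left (word j) (word i) ∨ word j = word i

instance (n d : ℕ) : Finite (Quilt n d) :=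
  Finite.of_injective (fun Q : Quilt n d => (Q.word, Q.tree)) (by
    intro P Q h
    exact Quilt.ext (congrArg Prod.fst h) (congrArg Prod.snd h))

noncomputable instance (n d : ℕ) : Fintype (Quilt n d) := Fintype.ofFinite _

/-- The quilt is labelled in the order of first occurrence of the vertices in its word. -/
def Quilt.IsOrdered {n d : ℕ} (Q : Quilt n d) : Prop :=
  ∀ x y : Fin n, x < y → FirstBefore Q.word x y

/-! ### Colorings -/

/-- A coloring of a tree for the arities `q`: each edge from `x` to `y` is labelled by one of the
`q x` inputs of `x`, increasingly with respect to the planar order of the children.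
Inputs are numbered from `0`. -/
@[ext]
structure TreeColoring {n : ℕ} (T : PlanarTree n) (q : Fin n → ℕ) where
  slot : ∀ e : T.Edge, Fin (q e.1.1)
  slot_lt : ∀ (x y z : Fin n) (hy : T.edge x y) (hz : T.edge x z), T.left y z →
    slot ⟨(x, y), hy⟩ < slot ⟨(x, z), hz⟩

instance {n : ℕ} (T : PlanarTree n) (q : Fin n → ℕ) : Finite (TreeColoring T q) :=
  Finite.of_injective (fun I : TreeColoring T q => I.slot) (fun _ _ h => TreeColoring.ext h)

noncomputable instance {n : ℕ} (T : PlanarTree n) (q : Fin n → ℕ) : Fintype (TreeColoring T q) :=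
  Fintype.ofFinite _

/-- The conditions on the functions `π a : [p a] → W` that belong to a coloring `ζ` of `W`. -/
structure IsWordColoring {n L : ℕ} (W : Fin L → Fin n) (p : Fin n → ℕ) (p' : ℕ)
    (ζ : ∀ a, Fin (p a + 1) ↪o Fin (p' + 1)) (π : ∀ a, Fin (p a + 1) → Fin L) : Prop where
  range_eq : ∀ a, Set.range (π a) = {i | W i = a}
  interval : ∀ i, (ζ (W i) '' (π (W i) ⁻¹' {i})).OrdConnected
  consecutive : ∀ i j : Fin L, (j : ℕ) = i + 1 → ∃ m,
    IsGreatest (ζ (W i) '' (π (W i) ⁻¹' {i})) m ∧ IsLeast (ζ (W j) '' (π (W j) ⁻¹' {j})) m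

/-- A coloring of a word `W`: strictly increasing maps `ζ a : [p a] → [p']` whose images cover
`[p']`, for which suitable functions `π a : [p a] → W` exist (these are then unique).
Here `[p] = {0, …, p}`. -/
@[ext]
structure WordColoring {n L : ℕ} (W : Fin L → Fin n) (p : Fin n → ℕ) (p' : ℕ) where
  ζ : ∀ a, Fin (p a + 1) ↪o Fin (p' + 1)
  cover : ∀ j, ∃ a i, ζ a i = j
  exists_pi : ∃ π, IsWordColoring W p p' ζ π

/-- The functions `π a : [p a] → W` of a coloring. -/
noncomputable def WordColoring.pi {n L : ℕ} {W : Fin L → Fin n} {p : Fin n → ℕ} {p' : ℕ}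
    (Z : WordColoring W p p') : ∀ a, Fin (p a + 1) → Fin L :=
  Z.exists_pi.choose

instance {n L : ℕ} (W : Fin L → Fin n) (p : Fin n → ℕ) (p' : ℕ) :
    Finite (WordColoring W p p') :=
  Finite.of_injective
    (fun Z : WordColoring W p p' => (fun a i => Z.ζ a i : ∀ a, Fin (p a + 1) → Fin (p' + 1))) (by
      intro Y Z h
      refine WordColoring.ext ?_
      funext a
      ext i
      exact congrArg Fin.val (congrFun (congrFun h a) i))

noncomputable instance {n L : ℕ} (W : Fin L → Fin n) (p : Fin n → ℕ) (p' : ℕ) :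
    Fintype (WordColoring W p p') :=
  Fintype.ofFinite _

/-- The left-to-right order of the inputs of the vertices of a colored tree: whether the `i`-th
input of `x` is before the `j`-th input of `y` (numbered from `0`). -/
def InputBefore {n : ℕ} (T : PlanarTree n) (I : T.Edge → ℕ) (x : Fin n) (i : ℕ) (y : Fin n)
    (j : ℕ) : Prop :=
  (x = y ∧ i < j) ∨ T.left x y ∨
    (∃ (c : Fin n) (e : T.edge x c), T.le c y ∧ i < I ⟨(x, c), e⟩) ∨
    (∃ (c : Fin n) (e : T.edge y c), T.le c x ∧ I ⟨(y, c), e⟩ ≤ j)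

/-! ### Signs -/

/-- The letters whose permutation defines the sign of a coloring: `p a` vertical letters
`0, …, p a - 1` and `q a - 1` horizontal letters `1, …, q a - 1` for each vertex `a`.
The horizontal letter `j` of `a` is `Sum.inr ⟨a, j - 1⟩`. -/
abbrev SLetter {n : ℕ} (p q : Fin n → ℕ) : Type :=
  (Σ a, Fin (p a)) ⊕ (Σ a, Fin (q a - 1))

/-- The order of the letters in the initial word: first by vertex, then the vertical letters before
the horizontal ones, then by number. -/
def InitialBefore {n : ℕ} {p q : Fin n → ℕ} : SLetter p q → SLetter p q → Prop
  | .inl x, .inl y => x.1 < y.1 ∨ (x.1 = y.1 ∧ (x.2 : ℕ) < y.2)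
  | .inl x, .inr y => x.1 ≤ y.1
  | .inr x, .inl y => x.1 < y.1
  | .inr x, .inr y => x.1 < y.1 ∨ (x.1 = y.1 ∧ (x.2 : ℕ) < y.2)

/-- The order of the letters in the shuffled word: first the vertical letters `0` of the interposed
vertices, in reverse order of first occurrence of these vertices in `W`; then the other vertical
letters, in the order of their positions, where `pos a i` is the position of the letter `i` of `a`;
then the horizontal letters, in the left-to-right order of the colored tree. -/
def ShuffledBefore {n L : ℕ} (W : Fin L → Fin n) (T : PlanarTree n) (I : T.Edge → ℕ)
    (pos : Fin n → ℕ → ℕ) {p q : Fin n → ℕ} : SLetter p q → SLetter p q → Prop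
  | .inl x, .inl y =>
      (((x.2 : ℕ) = 0 ∧ Interposed W x.1) ∧ ((y.2 : ℕ) = 0 ∧ Interposed W y.1) ∧
        FirstBefore W y.1 x.1) ∨
      (((x.2 : ℕ) = 0 ∧ Interposed W x.1) ∧ ¬ ((y.2 : ℕ) = 0 ∧ Interposed W y.1)) ∨
      (¬ ((x.2 : ℕ) = 0 ∧ Interposed W x.1) ∧ ¬ ((y.2 : ℕ) = 0 ∧ Interposed W y.1) ∧
        pos x.1 x.2 < pos y.1 y.2)
  | .inl _, .inr _ => True
  | .inr _, .inl _ => False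
  | .inr x, .inr y => InputBefore T I x.1 x.2 y.1 y.2

open Classical in
/-- The sign of the permutation from the initial word to the shuffled word: `-1` to the number of
pairs of letters whose order is reversed. -/
noncomputable def shuffleSign {n L : ℕ} (W : Fin L → Fin n) (T : PlanarTree n)
    (I : T.Edge → ℕ) (pos : Fin n → ℕ → ℕ) (p q : Fin n → ℕ) : ℤ :=
  (-1) ^ (Finset.univ.filter (fun z : SLetter p q × SLetter p q =>
    InitialBefore z.1 z.2 ∧ ShuffledBefore W T I pos z.2 z.1)).card

/-- An interposed vertex `a` with `p a = 0`; it occurs in `W` only once, if `W` has a coloring. -/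
def Degenerate {n L : ℕ} (W : Fin L → Fin n) (p : Fin n → ℕ) (a : Fin n) : Prop :=
  Interposed W a ∧ p a = 0

open Classical in
/-- The sign of a coloring `(ζ, I)` of the quilt `(W, T)`. It is the sign of the shuffle if
`q a ≠ 0` for all `a` and `p a ≠ 0` for all interposed `a`. In general, `q a = 0` is replaced by
`2`, and the coloring is expanded twice at each interposed vertex `a` with `p a = 0`: then `p a`
becomes `2`, the image `{m}` of `ζ a` becomes `{m, m + 1, m + 2}`, and all that comes from letters
of `W` after `a` moves up by `2`. -/
noncomputable def coloringSign {n L : ℕ} {W : Fin L → Fin n} {T : PlanarTree n}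
    {p q : Fin n → ℕ} {p' : ℕ} (Z : WordColoring W p p') (I : TreeColoring T q) : ℤ :=
  shuffleSign W T (fun e => (I.slot e : ℕ))
    (fun a i =>
      (Z.ζ a (Fin.ofNat (p a + 1) i) : ℕ)
        + 2 * (Finset.univ.filter (fun b : Fin n => Degenerate W p b ∧
            ∃ j : Fin L, j < Z.pi a (Fin.ofNat (p a + 1) i) ∧ W j = b)).card
        + (if Degenerate W p a then i else 0))
    (fun a => if Degenerate W p a then 2 else p a)
    (fun a => if q a = 0 then 2 else q a)

/-! ### The Hochschild bicomplex -/

section Bicomplex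

variable {k : Type t} [Field k] {C : Type u} [Category.{v} C]

/-- A `p`-simplex `x₀ ← x₁ ← ⋯ ← x_p` of the nerve of `C`, as a chain of arrows
`x₀ ⟶ x₁ ⟶ ⋯ ⟶ x_p` in the opposite category. -/
abbrev Simplex (C : Type u) [Category.{v} C] (p : ℕ) : Type (max u v) := ComposableArrows Cᵒᵖ p

namespace Simplex

variable {p : ℕ}

/-- The object `x_i` of a simplex. -/
abbrev vertex (φ : Simplex C p) (i : Fin (p + 1)) : C := (φ.obj i).unop

/-- The composite morphism `x_j ⟶ x_i` of a simplex, for `i ≤ j`. -/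
abbrev arrow (φ : Simplex C p) {i j : Fin (p + 1)} (h : i ≤ j) : φ.vertex j ⟶ φ.vertex i :=
  (φ.map (homOfLE h)).unop

/-- The pull-back `ζ^* φ` of a simplex. -/
abbrev pull {p' : ℕ} (φ : Simplex C p') (ζ : Fin (p + 1) ↪o Fin (p' + 1)) : Simplex C p :=
  φ.whiskerLeft ζ.monotone.functor

/-- Some component `x_{i+1} ⟶ x_i` of the simplex is an identity morphism. -/
def HasIdentity (φ : Simplex C p) : Prop :=
  ∃ (i : Fin p) (h : φ.vertex i.succ = φ.vertex i.castSucc),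
    φ.arrow (Fin.castSucc_le_succ i) = eqToHom h

/-- The `0`-simplex of an object. -/
abbrev ofObj (x : C) : Simplex C 0 := ComposableArrows.mk₀ (Opposite.op x)

/-- The `1`-simplex `y ← x` of a morphism `x ⟶ y`. -/
abbrev ofHom {x y : C} (φ : x ⟶ y) : Simplex C 1 := ComposableArrows.mk₁ φ.op

end Simplex

/-- The homomorphism of algebras `A[φ]` of a diagram of algebras. -/
abbrev algMap (A : C ⥤ NUAlg.{t, w} k) {x y : C} (φ : x ⟶ y) : A.obj x →ₙₐ[k] A.obj y := A.map φ

/-- `C^{p,q}(A, A)`: families of `q`-linear maps from `A(x_p)` to `A(x₀)`, indexed by the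
`p`-simplices `x₀ ← ⋯ ← x_p` of the nerve. -/
abbrev Cochain (A : C ⥤ NUAlg.{t, w} k) (p q : ℕ) : Type (max u v w) :=
  ∀ φ : Simplex C p,
    MultilinearMap k (fun _ : Fin q => A.obj (φ.vertex (Fin.last p))) (A.obj (φ.vertex 0))

/-- Families of cochains in all bidegrees; the homogeneous elements of the total complex are the
families that are supported in bidegrees `(p, q)` with constant `p + q`. -/
abbrev TotCochain (A : C ⥤ NUAlg.{t, w} k) : Type (max u v w) := ∀ p q : ℕ, Cochain A p q

/-- The values of an element of `C^{p,q}(A, A)`, in which operations on cochains are computed: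
`C^{p,q}(A, A)` consists of those families of functions that are multilinear. -/
abbrev Values (A : C ⥤ NUAlg.{t, w} k) (p q : ℕ) : Type (max u v w) :=
  ∀ φ : Simplex C p, (Fin q → A.obj (φ.vertex (Fin.last p))) → A.obj (φ.vertex 0)

/-- The values of a family of cochains in all bidegrees. -/
abbrev TotValues (A : C ⥤ NUAlg.{t, w} k) : Type (max u v w) := ∀ p q : ℕ, Values A p q

variable {A : C ⥤ NUAlg.{t, w} k}

open Classical in
/-- The map `A(x_j) → A(x_i)` of a simplex for `i ≤ j` (only this case occurs for a coloring of a
quilt). -/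
noncomputable def trans (A : C ⥤ NUAlg.{t, w} k) {p : ℕ} (φ : Simplex C p) (i j : Fin (p + 1)) :
    A.obj (φ.vertex j) →ₗ[k] A.obj (φ.vertex i) :=
  if h : i ≤ j then (algMap A (φ.arrow h) : A.obj (φ.vertex j) →ₗ[k] A.obj (φ.vertex i)) else 0

section Composition

variable {n p' : ℕ} {T : PlanarTree n} {p q : Fin n → ℕ}

/-- The `i`-th input of `x` is free, i.e. it is not the label of an edge. -/
def TreeColoring.IsFree (I : TreeColoring T q) (x : Fin n) (i : Fin (q x)) : Prop :=
  ¬ ∃ (c : Fin n) (e : T.edge x c), I.slot ⟨(x, c), e⟩ = i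

open Classical in
/-- The number of free inputs to the left of the `i`-th input of `x`. -/
noncomputable def TreeColoring.inputIndex (I : TreeColoring T q) (x : Fin n) (i : Fin (q x)) : ℕ :=
  (Finset.univ.filter (fun s : Σ y, Fin (q y) =>
    I.IsFree s.1 s.2 ∧ InputBefore T (fun e => (I.slot e : ℕ)) s.1 s.2 x i)).card

open Classical in
/-- The element of `A(x_{ζ_x(0)})` that results at the vertex `x` when the cochains `f` are
composed according to the colored tree and applied to the arguments `a`, which are fed, in order,
to the free inputs. The first argument bounds the depth of the recursion; any value that exceeds
the height of the subtree at `x` gives the same result. -/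
noncomputable def evalAt {q' : ℕ} (ζ : ∀ x, Fin (p x + 1) ↪o Fin (p' + 1)) (I : TreeColoring T q)
    (f : ∀ x, Cochain A (p x) (q x)) (φ : Simplex C p')
    (a : Fin q' → A.obj (φ.vertex (Fin.last p'))) :
    ℕ → ∀ x : Fin n, A.obj (φ.vertex (ζ x 0))
  | 0, _ => 0
  | m + 1, x => f x (φ.pull (ζ x)) (fun i =>
      if h : ∃ c, ∃ e : T.edge x c, I.slot ⟨(x, c), e⟩ = i then
        trans A φ (ζ x (Fin.last (p x))) (ζ h.choose 0) (evalAt ζ I f φ a m h.choose)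
      else
        trans A φ (ζ x (Fin.last (p x))) (Fin.last p')
          (if hi : I.inputIndex x i < q' then a ⟨I.inputIndex x i, hi⟩ else 0))

/-- The composition `L(ζ, I; f)` of cochains according to a colored quilt. -/
noncomputable def composeCochains (ζ : ∀ x, Fin (p x + 1) ↪o Fin (p' + 1)) (I : TreeColoring T q)
    (f : ∀ x, Cochain A (p x) (q x)) (q' : ℕ) : Values A p' q' :=
  fun φ a => trans A φ 0 (ζ T.root 0) (evalAt ζ I f φ a n T.root)

end Composition

/-- The action of a quilt of arity `n` and degree `d` on families of cochains: the sum over all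
choices of components `f a ∈ C^{p a, q a}` with `∑ p a = p' + d` and `∑ q a = q' + n - 1`, and over
all colorings. -/
noncomputable def Quilt.act {n d : ℕ} (Q : Quilt n d) (f : Fin n → TotCochain A) : TotValues A :=
  fun p' q' =>
    ∑ p ∈ Finset.Nat.antidiagonalTuple n (p' + d),
      ∑ q ∈ Finset.Nat.antidiagonalTuple n (q' + n - 1),
        ∑ Z : WordColoring Q.word p p', ∑ I : TreeColoring Q.tree q,
          coloringSign Z I • composeCochains Z.ζ I (fun x => f x (p x) (q x)) q'

/-! ### Coboundaries -/

/-- The simplicial coboundary, the alternating sum over the face maps `ε_i : [p] → [p + 1]`. -/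
noncomputable def deltaS (f : TotCochain A) : TotValues A
  | 0, _ => 0
  | p + 1, q => fun φ a => ∑ i : Fin (p + 2), (-1 : ℤ) ^ (i : ℕ) •
      trans A φ 0 (Fin.succAboveOrderEmb i 0) (f p q (φ.pull (Fin.succAboveOrderEmb i))
        (fun j => trans A φ (Fin.succAboveOrderEmb i (Fin.last p)) (Fin.last (p + 1)) (a j)))

end Bicomplex

theorem edge_reflTransGen {r c : Fin 2} (h : r ≠ c) {x y : Fin 2} :
    Relation.ReflTransGen (fun a b : Fin 2 => a = r ∧ b = c) x y ↔ x = y ∨ (x = r ∧ y = c) := by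
  constructor
  · intro hxy
    induction hxy with
    | refl => exact Or.inl rfl
    | tail _ hbc ih =>
      obtain ⟨rfl, rfl⟩ := hbc
      rcases ih with rfl | ⟨_, h2⟩
      · exact Or.inr ⟨rfl, rfl⟩
      · exact absurd h2 h
  · rintro (rfl | hxy)
    · exact Relation.ReflTransGen.refl
    · exact Relation.ReflTransGen.single hxy

/-- The tree with the root `r` and one other vertex `c`. -/
def edgeTree (r c : Fin 2) (h : r ≠ c) : PlanarTree 2 where
  edge x y := x = r ∧ y = c
  left _ _ := False
  edge_irrefl := by
    rintro x ⟨h1, h2⟩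
    exact h (h1 ▸ h2)
  le_antisymm := by
    intro x y
    rw [edge_reflTransGen h, edge_reflTransGen h]
    grind
  existsUnique_root := by
    simp only [edge_reflTransGen h]
    refine ⟨r, by grind, fun y hy => ?_⟩
    have := hy r
    grind
  edge_covers := by
    intro x y
    simp only [edge_reflTransGen h]
    grind
  left_irrefl := by simp
  left_trans := by simp
  left_comparable_iff := by
    intro x y
    simp only [edge_reflTransGen h]
    grind
  left_inherit := by simp

/-- The quilt with the word `r c` and with the tree in which `r` is the parent of `c`. -/
def edgeQuilt (r c : Fin 2) (h : r ≠ c) : Quilt 2 0 where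
  word := ![r, c]
  tree := edgeTree r c h
  isWord :=
    { surjective := by
        intro x
        rcases (by grind : x = r ∨ x = c) with rfl | rfl
        · exact ⟨0, rfl⟩
        · exact ⟨1, rfl⟩
      nondegenerate := by
        intro i j hij
        fin_cases i <;> fin_cases j <;> first | exact h | simp at hij
      not_interlaced := by
        intro i j k l h1 h2 h3
        omega }
  not_lt := by
    intro i j hij
    have key : ¬ ((edgeTree r c h).le c r ∧ c ≠ r) := by
      rintro ⟨h1, h2⟩
      rcases (edge_reflTransGen h).1 h1 with h3 | ⟨h3, _⟩
      · exact h2 h3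
      · exact h h3.symm
    fin_cases i <;> fin_cases j <;> first | exact key | simp at hij
  left_of := by
    intro i j k h1 h2
    omega

section MaurerCartan

variable {k : Type t} [Field k] {C : Type u} [Category.{v} C]

/-- The multiplication of the diagram `A`, as a family of cochains with the single component
`(x; a, b) ↦ a b` in bidegree `(0, 2)`. -/
def mulCochain (A : C ⥤ NUAlg.{t, w} k) : TotCochain A
  | 0, 2 => fun φ =>
    { toFun := fun a => (a 0 * a 1 : A.obj (φ.vertex 0))
      map_update_add' := by
        intro _ a i x y
        fin_cases i <;> simp [add_mul, mul_add]
      map_update_smul' := by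
        intro _ a i c x
        fin_cases i <;> simp [smul_mul_assoc, mul_smul_comm] }
  | _, _ => 0

variable {A : C ⥤ NUAlg.{t, w} k}

/-- The Hochschild coboundary. -/
noncomputable def deltaH (f : TotCochain A) : TotValues A :=
  (edgeQuilt 0 1 (by decide)).act ![mulCochain A, f]
    - (edgeQuilt 1 0 (by decide)).act ![mulCochain A, f]

open Classical in
/-- The operation `P⁰_n`: up to the sign `(-1)^(1 + n (n - 1) / 2)`, the sum of all quilts of arity
`n` and degree `n - 2` that are labelled in the order of first occurrence. -/
noncomputable def opP0 (n : ℕ) (f : Fin n → TotCochain A) : TotValues A :=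
  (-1 : ℤ) ^ (1 + n * (n - 1) / 2) •
    ∑ Q ∈ Finset.univ.filter (fun Q : Quilt n (n - 2) => Q.IsOrdered), Q.act f

/-- The operation `P_n = P⁰_n + P⁰_{n+1} ∘₁ m`. -/
noncomputable def opP (n : ℕ) (f : Fin n → TotCochain A) : TotValues A :=
  opP0 n f + opP0 (n + 1) (Fin.cons (mulCochain A) f)

/-- `f` is a solution of the Maurer-Cartan equation `δ f + ∑_{n ≥ 2} P_n(f, …, f) = 0`, where
`δ` is the sum of the simplicial and the Hochschild coboundary. The sum is required to have
only finitely many nonzero terms. -/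
def IsMaurerCartan (f : TotCochain A) : Prop :=
  {n : ℕ | 2 ≤ n ∧ opP n (fun _ => f) ≠ 0}.Finite ∧
    deltaS f + deltaH f + ∑ᶠ (n : ℕ) (_ : 2 ≤ n), opP n (fun _ => f) = 0

/-- `f` is homogeneous of shifted total degree `d`, where `C^{p,q}` has shifted total degree
`p + q - 1`. -/
def HasShiftedDegree (f : TotCochain A) (d : ℤ) : Prop :=
  ∀ p q : ℕ, (p : ℤ) + q - 1 ≠ d → f p q = 0

/-- `f` is in the asimplicial subcomplex: only components with `q ≥ 1` occur. -/
def IsAsimplicial (f : TotCochain A) : Prop := ∀ p, f p 0 = 0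

/-- `f` is in the normalized subcomplex: it vanishes on simplices that contain an identity. -/
def IsNormalized (f : TotCochain A) : Prop :=
  ∀ (p q : ℕ) (φ : Simplex C p), φ.HasIdentity → f p q φ = 0

/-- The bilinear operation on `A(x)` that is the component of `f` in `C^{0,2}` at `x`. -/
def binaryPart (f : TotCochain A) (x : C) (a b : A.obj x) : A.obj x :=
  f 0 2 (Simplex.ofObj x) ![a, b]

/-- The linear map `A(x) → A(y)` that is the component of `f` in `C^{1,1}` at `φ : x ⟶ y`. -/
def unaryPart (f : TotCochain A) {x y : C} (φ : x ⟶ y) (a : A.obj x) : A.obj y :=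
  f 1 1 (Simplex.ofHom φ) ![a]

/-! ### Deformations -/

/-- A deformation of `A` as a diagram of algebras: the structure of a diagram of associative
algebras on the same vector spaces `A(x)`. It consists of associative multiplications on these
spaces and of linear maps that are homomorphisms of these algebras and that form a functor. -/
@[ext]
structure DiagramDeformation (A : C ⥤ NUAlg.{t, w} k) where
  mul : ∀ x : C, A.obj x →ₗ[k] A.obj x →ₗ[k] A.obj x
  map : ∀ {x y : C}, (x ⟶ y) → (A.obj x →ₗ[k] A.obj y)
  mul_assoc : ∀ (x : C) (a b c : A.obj x), mul x (mul x a b) c = mul x a (mul x b c)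
  map_mul : ∀ {x y : C} (φ : x ⟶ y) (a b : A.obj x), map φ (mul x a b) = mul y (map φ a) (map φ b)
  map_id : ∀ (x : C), map (𝟙 x) = LinearMap.id
  map_comp : ∀ {x y z : C} (φ : x ⟶ y) (ψ : y ⟶ z), map (φ ≫ ψ) = map ψ ∘ₗ map φ

end MaurerCartan

end HochschildMC

/-! A cochain `F = f + g` of shifted degree one without components in `q = 0` lives in the bidegrees
(0,2) and (1,1), as does the multiplication `m`. A degree count then confines the left side of the
Maurer-Cartan equation to the bidegrees (0,3), (1,2) and (2,1) (`curvature_eq_zero`). There it is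
the associator of `m + f`, the failure of `A + g` to be multiplicative for `m + f`, and the failure
of `A + g` to respect composition (`curvature_zero_three`, `curvature_one_two`,
`curvature_two_one`). Normalization of `g` takes care of identities, and subtracting the undeformed
structure inverts the construction.

The main point is that the infinite sum collapses. Let a colored quilt of arity `n ≥ 3` and degree
`n - 2` over `[p']` contribute. Each vertex has `p + q = 2` and `q ≥ 1`, and `∑ p = p' + n - 2`, so
exactly `2 - p'` vertices are binary. A letter can enclose another one only if the latter is to its
left, and left-of requires a branching, hence a binary vertex. For `p' = 2` the tree is therefore a
chain, no letter is repeated, and the word has more letters than the `n` available. For `p' = 0` all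
`p` vanish, although their sum is `n - 2 > 0`. For `p' = 1` there is one binary vertex. If two
letters were repeated, one would enclose the other, and this would give three vertices in a row for
the left-of order, which a single binary branching does not allow. So the word has at most `n + 1`
letters and `n ≤ 3`.

In arity three the only ordered quilt left is the word `0 1 2 1` on a root `0` with children `2`,
`1` (`Quilt.eq_cherryQuilt`); in arity two there is only the one-edge quilt. Hence `P_2(F,F)` is the
one-edge quilt on `(F,F)` plus the cherry on `(m,F,F)`, and `P_3(F,F,F)` is the cherry on `(F,F,F)`.
The cherry supplies the term `-(m + f)(g a, g b)` of the multiplicativity condition. Each remaining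
quilt has few colorings, which are listed, and their signs are finite inversion counts. -/

namespace HochschildMC

universe t u v w

/-! ### Branching in planar trees and in their colorings -/

namespace PlanarTree

variable {n : ℕ} (T : PlanarTree n)

/-- Passing to proper ancestors terminates because the vertex set is finite; it ends at a minimal
vertex, and the root is the only one. -/
theorem root_le (x : Fin n) : T.le T.root x := by
  have hwf : WellFounded (fun y x : Fin n => T.le y x ∧ y ≠ x) := by
    have : IsTrans (Fin n) (fun y x : Fin n => T.le y x ∧ y ≠ x) :=
      ⟨fun a b c h1 h2 => ⟨Relation.ReflTransGen.trans h1.1 h2.1, by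
        rintro rfl
        exact h1.2 (T.le_antisymm _ _ h1.1 h2.1)⟩⟩
    have : Std.Irrefl (fun y x : Fin n => T.le y x ∧ y ≠ x) := ⟨fun a h => h.2 rfl⟩
    exact Finite.wellFounded_of_trans_of_irrefl _
  induction x using hwf.induction with
  | _ x ih =>
    by_cases h : ∀ y, T.le y x → x = y
    · have := T.existsUnique_root.unique T.existsUnique_root.choose_spec.1
        (fun y hy => (h y hy).symm)
      rw [root, this]
      exact Relation.ReflTransGen.refl
    · push Not at h
      obtain ⟨y, h1, h2⟩ := h
      exact Relation.ReflTransGen.trans (ih y ⟨h1, h2.symm⟩) h1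

variable {T}

theorem root_eq {r : Fin n} (h : ∀ x, T.le x r → x = r) : T.root = r :=
  h _ (T.root_le r)

theorem not_le_of_left {x y : Fin n} (h : T.left x y) : ¬ T.le x y ∧ ¬ T.le y x := by
  have hne : x ≠ y := by
    rintro rfl
    exact T.left_irrefl _ h
  have := (T.left_comparable_iff x y hne).1 (Or.inl h)
  exact not_or.1 this

/-- Edges are covering relations, so siblings are incomparable. -/
theorem left_or_left_of_edge {z x y : Fin n} (hx : T.edge z x) (hy : T.edge z y) (h : x ≠ y) :
    T.left x y ∨ T.left y x := by
  have key : ∀ {x y : Fin n}, T.edge z x → T.edge z y → x ≠ y → ¬ T.le x y := by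
    intro x y hx hy h hle
    refine T.edge_covers z y hy ⟨x, ⟨Relation.ReflTransGen.single hx, ?_⟩, hle, h⟩
    rintro rfl
    exact T.edge_irrefl _ hx
  rw [T.left_comparable_iff x y h]
  exact not_or.2 ⟨key hx hy h, key hy hx h.symm⟩

/-- Incomparable vertices lie over different children of some vertex. -/
theorem exists_branch {x y : Fin n} (h : T.left x y) :
    ∃ z u v, T.edge z u ∧ T.edge z v ∧ T.left u v ∧ T.le u x ∧ T.le v y := by
  -- The induction follows the path from a common ancestor `w` towards `x` until the next vertex is
  -- no longer an ancestor of `y`.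
  have key : ∀ w, T.le w x → T.le w y →
      ∃ z u v, T.edge z u ∧ T.edge z v ∧ T.left u v ∧ T.le u x ∧ T.le v y := by
    intro w hw
    induction hw using Relation.ReflTransGen.head_induction_on with
    | refl => exact fun hxy => absurd hxy (not_le_of_left h).1
    | head hwu hux ih =>
      rename_i w u
      intro hwy
      by_cases huy : T.le u y
      · exact ih huy
      · rcases Relation.ReflTransGen.cases_head hwy with rfl | ⟨v, hwv, hvy⟩
        · exact absurd (Relation.ReflTransGen.head hwu hux) (not_le_of_left h).2
        · refine ⟨w, u, v, hwu, hwv, ?_, hux, hvy⟩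
          have huv : u ≠ v := by
            rintro rfl
            exact huy hvy
          -- The opposite order of the siblings would be inherited by `y` and `x`, against `left x
          -- y`.
          refine (left_or_left_of_edge hwu hwv huv).resolve_right fun hvu => ?_
          exact T.left_irrefl _ (T.left_trans _ _ _ h (T.left_inherit _ _ _ _ hvu hvy hux))
  exact key _ (T.root_le x) (T.root_le y)

end PlanarTree

namespace TreeColoring

variable {n : ℕ} {T : PlanarTree n} {q : Fin n → ℕ}

theorem slot_injective (I : TreeColoring T q) {x y z : Fin n} (hy : T.edge x y) (hz : T.edge x z)
    (h : I.slot ⟨(x, y), hy⟩ = I.slot ⟨(x, z), hz⟩) : y = z := by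
  by_contra hne
  rcases PlanarTree.left_or_left_of_edge hy hz hne with hl | hl
  · exact (I.slot_lt _ _ _ hy hz hl).ne h
  · exact (I.slot_lt _ _ _ hz hy hl).ne h.symm

/-- The two siblings at the branching carry different labels among the `q z` inputs. This converts
the planar order into a lower bound for an arity. -/
theorem exists_branch (I : TreeColoring T q) {x y : Fin n} (h : T.left x y) :
    ∃ z u v, T.edge z u ∧ T.edge z v ∧ T.left u v ∧ T.le u x ∧ T.le v y ∧ 2 ≤ q z := by
  obtain ⟨z, u, v, hu, hv, huv, hux, hvy⟩ := PlanarTree.exists_branch h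
  refine ⟨z, u, v, hu, hv, huv, hux, hvy, ?_⟩
  have h1 : (I.slot ⟨(z, u), hu⟩ : ℕ) < I.slot ⟨(z, v), hv⟩ := I.slot_lt _ _ _ hu hv huv
  have h2 : (I.slot ⟨(z, v), hv⟩ : ℕ) < q z := (I.slot ⟨(z, v), hv⟩).2
  omega

/-- If only the vertex `b` can have several children, and at most two, then there are no chains
of three vertices in the planar order. -/
theorem not_left_left (I : TreeColoring T q) {b : Fin n} (hb : q b ≤ 2)
    (hq : ∀ a, a ≠ b → q a ≤ 1) {x y z : Fin n} (hxy : T.left x y) (hyz : T.left y z) : False := by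
  obtain ⟨c, u, v, hu, hv, huv, -, hvy, hc⟩ := I.exists_branch hxy
  obtain ⟨d, s, t, hs, ht, hst, hsy, -, hd⟩ := I.exists_branch hyz
  obtain rfl : c = b := by
    by_contra h
    have := hq c h
    omega
  obtain rfl : d = c := by
    by_contra h
    have := hq d h
    omega
  have h1 : (I.slot ⟨(d, u), hu⟩ : ℕ) < I.slot ⟨(d, v), hv⟩ := I.slot_lt _ _ _ hu hv huv
  have h2 : (I.slot ⟨(d, s), hs⟩ : ℕ) < I.slot ⟨(d, t), ht⟩ := I.slot_lt _ _ _ hs ht hst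
  have h3 : (I.slot ⟨(d, v), hv⟩ : ℕ) < q d := (I.slot ⟨(d, v), hv⟩).2
  have h4 : (I.slot ⟨(d, t), ht⟩ : ℕ) < q d := (I.slot ⟨(d, t), ht⟩).2
  -- With at most two inputs, `v` carries the label `1` and `s` the label `0`. They are then
  -- distinct siblings that are both ancestors of `y`.
  have hvs : v ≠ s := by
    rintro rfl
    omega
  rcases PlanarTree.left_or_left_of_edge hv hs hvs with hl | hl
  · exact T.left_irrefl _ (T.left_inherit _ _ _ _ hl hvy hsy)
  · exact T.left_irrefl _ (T.left_inherit _ _ _ _ hl hsy hvy)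

/-- Incomparable vertices lie over the only vertex that can have several children. -/
theorem exists_children_of_left (I : TreeColoring T q) {b : Fin n}
    (hq : ∀ a, a ≠ b → q a ≤ 1) {x y : Fin n} (hxy : T.left x y) :
    ∃ u v, T.edge b u ∧ T.edge b v ∧ T.le u x ∧ T.le v y ∧ T.left u v := by
  obtain ⟨c, u, v, hu, hv, huv, hux, hvy, hc⟩ := I.exists_branch hxy
  obtain rfl : c = b := by
    by_contra h
    have := hq c h
    omega
  exact ⟨u, v, hu, hv, hux, hvy, huv⟩

end TreeColoring

/-! ### Colorings of words -/

namespace IsWordColoring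

variable {n L : ℕ} {W : Fin L → Fin n} {p : Fin n → ℕ} {p' : ℕ}
  {ζ : ∀ a, Fin (p a + 1) ↪o Fin (p' + 1)} {π : ∀ a, Fin (p a + 1) → Fin L}

theorem word_pi (h : IsWordColoring W p p' ζ π) (a : Fin n) (i : Fin (p a + 1)) :
    W (π a i) = a := by
  have : π a i ∈ Set.range (π a) := ⟨i, rfl⟩
  rw [h.range_eq] at this
  exact this

theorem exists_pi_eq (h : IsWordColoring W p p' ζ π) {i : Fin L} {a : Fin n} (hi : W i = a) :
    ∃ s, π a s = i := by
  have : i ∈ {j | W j = a} := hi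
  rw [← h.range_eq] at this
  exact this

/-- The intervals of the letters of a word occur in increasing order. -/
theorem le_of_lt (h : IsWordColoring W p p' ζ π) {i j : Fin L} (hij : i < j)
    {m m' : Fin (p' + 1)} (hm : m ∈ ζ (W i) '' (π (W i) ⁻¹' {i}))
    (hm' : m' ∈ ζ (W j) '' (π (W j) ⁻¹' {j})) : m ≤ m' := by
  -- Induction on the distance of the two letters: the intervals of adjacent letters share an end
  -- point.
  have key : ∀ (d : ℕ) (j : Fin L), (j : ℕ) = i + d + 1 →
      ∀ m' ∈ ζ (W j) '' (π (W j) ⁻¹' {j}), m ≤ m' := by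
    intro d
    induction d with
    | zero =>
      intro j hj m' hm'
      obtain ⟨c, hc, hc'⟩ := h.consecutive i j hj
      exact (hc.2 hm).trans (hc'.2 hm')
    | succ d ih =>
      intro j hj m' hm'
      obtain ⟨c, hc, hc'⟩ := h.consecutive ⟨i + d + 1, by omega⟩ j (by simp; omega)
      exact (ih _ rfl _ hc.1).trans (hc'.2 hm')
  refine key (j - i - 1) j ?_ m' hm'
  have : (i : ℕ) < j := hij
  omega

theorem zeta_le_of_pi_lt (h : IsWordColoring W p p' ζ π) {a b : Fin n} {s : Fin (p a + 1)}
    {t : Fin (p b + 1)} (hst : π a s < π b t) : ζ a s ≤ ζ b t := by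
  refine h.le_of_lt hst ?_ ?_
  · rw [h.word_pi]
    exact ⟨s, rfl, rfl⟩
  · rw [h.word_pi]
    exact ⟨t, rfl, rfl⟩

theorem pi_mono (h : IsWordColoring W p p' ζ π) {a : Fin n} {s t : Fin (p a + 1)}
    (hst : s ≤ t) : π a s ≤ π a t := by
  rcases hst.eq_or_lt with rfl | hst
  · exact le_rfl
  · by_contra hlt
    have := h.zeta_le_of_pi_lt (not_le.1 hlt)
    rw [(ζ a).le_iff_le] at this
    exact absurd this (not_le.2 hst)

/-- The map `π a` sends `p a + 1` elements onto the occurrences of `a`. -/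
theorem card_fiber_le (h : IsWordColoring W p p' ζ π) (a : Fin n) :
    (Finset.univ.filter (fun i => W i = a)).card ≤ p a + 1 := by
  have : Finset.univ.filter (fun i => W i = a) ⊆ Finset.univ.image (π a) := by
    intro i hi
    obtain ⟨s, hs⟩ := h.exists_pi_eq (a := a) (by simpa using hi)
    exact Finset.mem_image.2 ⟨s, Finset.mem_univ _, hs⟩
  refine (Finset.card_le_card this).trans (Finset.card_image_le.trans ?_)
  simp

end IsWordColoring

/-! ### Bounds for the arity of contributing quilts -/

namespace Quilt

variable {n d : ℕ}

/-- A letter that occurs twice in the word of a quilt has a letter to its left. -/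
theorem exists_left_of_repeated (Q : Quilt n d) {i k : Fin (n + d)} (hik : i < k)
    (h : Q.word i = Q.word k) : ∃ x, Q.tree.left x (Q.word i) := by
  have h1 : (i : ℕ) + 1 < n + d := by
    have : (i : ℕ) < k := hik
    omega
  have h2 := Q.isWord.nondegenerate i ⟨i + 1, h1⟩ rfl
  have h3 : (⟨i + 1, h1⟩ : Fin (n + d)) < k := by
    refine lt_of_le_of_ne (show (i : ℕ) + 1 ≤ k from hik) ?_
    intro h3
    rw [h3] at h2
    exact h2 h
  exact ⟨_, (Q.left_of i _ k (Fin.lt_def.2 (Nat.lt_succ_self _)) h3 h).resolve_right h2.symm⟩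

/-- Without a binary vertex nothing is to the left of anything, so no letter is repeated. The length
`n + d = 2 n - 2` of the word is then at most `n`. -/
theorem arity_le_two (Q : Quilt n d) {q : Fin n → ℕ} (hd : n = d + 2)
    (I : TreeColoring Q.tree q) (hq : ∀ a, q a ≤ 1) : n ≤ 2 := by
  have hinj : Function.Injective Q.word := by
    have key : ∀ i k, i < k → Q.word i ≠ Q.word k := by
      intro i k hik h
      obtain ⟨x, hx⟩ := Q.exists_left_of_repeated hik h
      obtain ⟨z, -, -, -, -, -, -, -, hz⟩ := I.exists_branch hx
      have := hq z
      omega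
    intro i k h
    by_contra hne
    rcases lt_or_gt_of_ne hne with hlt | hlt
    · exact key _ _ hlt h
    · exact key _ _ hlt h.symm
  have := Fintype.card_le_of_injective _ hinj
  simp at this
  omega

end Quilt

namespace Quilt

variable {n d : ℕ}

/-- In a coloring over `[1]` in which only the vertex `b` has several inputs, and at most two, at
most one letter is repeated. -/
theorem repeated_unique (Q : Quilt n d) {p q : Fin n → ℕ} {b : Fin n} (hqb : q b ≤ 2)
    (hq : ∀ a, a ≠ b → q a ≤ 1) (Z : WordColoring Q.word p 1)
    (I : TreeColoring Q.tree q) {i k i' k' : Fin (n + d)}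
    (hik : i < k) (hik' : i' < k') (h : Q.word i = Q.word k) (h' : Q.word i' = Q.word k') :
    Q.word i = Q.word i' := by
  obtain ⟨π, hπ⟩ := Z.exists_pi
  -- Over `[1]` there is room for two values only: the first occurrence takes `0` and the second one
  -- `1`.
  have key : ∀ {i k : Fin (n + d)}, i < k → Q.word i = Q.word k →
      ∃ s t, π (Q.word i) s = i ∧ π (Q.word i) t = k ∧ Z.ζ (Q.word i) s = 0 ∧
        Z.ζ (Q.word i) t = 1 := by
    intro i k hik h
    obtain ⟨s, hs⟩ := hπ.exists_pi_eq (i := i) rfl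
    obtain ⟨t, ht⟩ := hπ.exists_pi_eq h.symm
    have hst : s < t := by
      by_contra hlt
      have := hπ.pi_mono (_root_.not_lt.1 hlt)
      rw [hs, ht] at this
      exact absurd this (not_le.2 hik)
    have hz : Z.ζ _ s < Z.ζ _ t := (Z.ζ _).lt_iff_lt.2 hst
    exact ⟨s, t, hs, ht, (by decide : ∀ x y : Fin (1 + 1), x < y → x = 0 ∧ y = 1) _ _ hz⟩
  have key2 : ∀ {i k i' k' : Fin (n + d)}, i < k → i' < k' → Q.word i = Q.word k →
      Q.word i' = Q.word k' → i < i' → Q.word i = Q.word i' := by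
    intro i k i' k' hik hik' h h' hii'
    by_contra hne
    obtain ⟨s, t, hs, ht, hzs, hzt⟩ := key hik h
    obtain ⟨s', t', hs', ht', hzs', hzt'⟩ := key hik' h'
    -- The later of the two repeated letters begins at `0`, while the occurrence `k` is already at
    -- `1`.
    have h1 : i' < k := by
      by_contra hlt
      rcases (_root_.not_lt.1 hlt).eq_or_lt with heq | hlt
      · exact hne (by rw [h, heq])
      · rw [← ht, ← hs'] at hlt
        have := hπ.zeta_le_of_pi_lt hlt
        rw [hzt, hzs'] at this
        exact absurd this (by decide)
    -- The enclosed letter is to the left of the enclosing one and, being repeated, has itself a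
    -- letter to its left: three vertices in a row.
    have h2 := (Q.left_of i i' k hii' h1 h).resolve_right (fun h => hne h.symm)
    obtain ⟨x, hx⟩ := Q.exists_left_of_repeated hik' h'
    exact I.not_left_left hqb hq hx h2
  rcases lt_trichotomy i i' with hlt | rfl | hlt
  · exact key2 hik hik' h h' hlt
  · rfl
  · exact (key2 hik' hik h' h hlt).symm

/-- At most one letter is repeated, and it occurs twice because `p a ≤ 1`. So `n + d ≤ n + 1`, which
means `d ≤ 1`. -/
theorem arity_le_three (Q : Quilt n d) (hd : n = d + 2) {p q : Fin n → ℕ} {b : Fin n}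
    (hpb : p b = 0) (hp : ∀ a, a ≠ b → p a = 1) (hqb : q b ≤ 2) (hq : ∀ a, a ≠ b → q a ≤ 1)
    (Z : WordColoring Q.word p 1) (I : TreeColoring Q.tree q) : n ≤ 3 := by
  classical
  obtain ⟨π, hπ⟩ := Z.exists_pi
  set occ : Fin n → ℕ := fun a => (Finset.univ.filter (fun i => Q.word i = a)).card with hocc
  have hsum : n + d = ∑ a, occ a := by
    have := Finset.card_eq_sum_card_fiberwise (f := Q.word) (s := Finset.univ)
      (t := Finset.univ) (fun _ _ => Finset.mem_univ _)
    simpa using this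
  have hocc2 : ∀ a, occ a ≤ 2 := by
    intro a
    have h1 : occ a ≤ p a + 1 := hπ.card_fiber_le a
    by_cases hab : a = b
    · subst hab
      omega
    · have := hp a hab
      omega
  have hrep : ∀ a, 1 < occ a → ∃ i k, i < k ∧ Q.word i = a ∧ Q.word i = Q.word k := by
    intro a ha
    obtain ⟨i, hi, k, hk, hne⟩ := Finset.one_lt_card.1 ha
    simp only [Finset.mem_filter, Finset.mem_univ, true_and] at hi hk
    rcases lt_or_gt_of_ne hne with hlt | hlt
    · exact ⟨i, k, hlt, hi, hi.trans hk.symm⟩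
    · exact ⟨k, i, hlt, hk, hk.trans hi.symm⟩
  have hcard : (Finset.univ.filter (fun a => 1 < occ a)).card ≤ 1 := by
    rw [Finset.card_le_one]
    intro a ha a' ha'
    simp only [Finset.mem_filter, Finset.mem_univ, true_and] at ha ha'
    obtain ⟨i, k, hik, rfl, h⟩ := hrep a ha
    obtain ⟨i', k', hik', rfl, h'⟩ := hrep a' ha'
    exact Q.repeated_unique hqb hq Z I hik hik' h h'
  have hle : ∑ a, occ a ≤ ∑ a, (1 + if 1 < occ a then 1 else 0) := by
    refine Finset.sum_le_sum fun a _ => ?_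
    have := hocc2 a
    split_ifs <;> omega
  rw [Finset.sum_add_distrib, ← Finset.card_filter] at hle
  simp at hle hcard
  omega

end Quilt

/-! ### The contributing quilts of arity two and three -/

theorem starEdge_reflTransGen {x y : Fin 3} :
    Relation.ReflTransGen (fun a b : Fin 3 => a = 0 ∧ b ≠ 0) x y ↔ x = y ∨ x = 0 := by
  constructor
  · intro h
    induction h with
    | refl => exact Or.inl rfl
    | tail _ hbc ih =>
      rcases ih with rfl | h
      · exact Or.inr hbc.1
      · exact Or.inr h
  · rintro (rfl | rfl)
    · exact Relation.ReflTransGen.refl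
    · by_cases h : y = 0
      · subst h
        exact Relation.ReflTransGen.refl
      · exact Relation.ReflTransGen.single ⟨rfl, h⟩

/-- The tree with the root `0` and its children `2` and `1`, from left to right. -/
def cherryTree : PlanarTree 3 where
  edge x y := x = 0 ∧ y ≠ 0
  left x y := x = 2 ∧ y = 1
  edge_irrefl := by simp
  le_antisymm := by
    intro x y
    rw [starEdge_reflTransGen, starEdge_reflTransGen]
    grind
  existsUnique_root := by
    simp only [starEdge_reflTransGen]
    refine ⟨0, by simp, fun y hy => ?_⟩
    exact (hy 0 (Or.inr rfl)).symm
  edge_covers := by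
    intro x y
    simp only [starEdge_reflTransGen]
    grind
  left_irrefl := by decide
  left_trans := by decide
  left_comparable_iff := by
    simp only [starEdge_reflTransGen]
    decide
  left_inherit := by
    simp only [starEdge_reflTransGen]
    decide

/-- The quilt with the word `0 1 2 1` whose tree has the root `0` and its children `2` and `1`. -/
def cherryQuilt : Quilt 3 1 where
  word := ![0, 1, 2, 1]
  tree := cherryTree
  isWord := ⟨by decide, by decide, by decide⟩
  not_lt := by
    simp only [PlanarTree.le, cherryTree, starEdge_reflTransGen]
    decide
  left_of := by
    simp only [cherryTree]
    decide

theorem cherryQuilt_isOrdered : cherryQuilt.IsOrdered := by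
  simp only [Quilt.IsOrdered, FirstBefore, cherryQuilt]
  decide

/-- An exhaustive search. In the last two words the first letter encloses another one, which the
tree will exclude. -/
theorem word_cases (W : Fin 4 → Fin 3) (h1 : ∀ i j : Fin 4, (j : ℕ) = i + 1 → W i ≠ W j)
    (h2 : Function.Surjective W) (h3 : ∀ x y : Fin 3, x < y → FirstBefore W x y) :
    W = ![0, 1, 2, 1] ∨ W = ![0, 1, 2, 0] ∨ W = ![0, 1, 0, 2] := by
  simp only [FirstBefore, Function.Surjective] at h2 h3
  revert W
  decide

/-- If `0` enclosed `1`, then `1` would be left of `0`, and the branching vertex `b` would be a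
proper ancestor of `0`; but it occurs after `0` in the word, which a quilt forbids. So the word is
`0 1 2 1`, and `2` is left of `1`. The vertex `b` is a proper ancestor of both, hence it is `0`,
with `2` and `1` as its children. -/
theorem Quilt.eq_cherryQuilt (Q : Quilt 3 1) (hQ : Q.IsOrdered) {q : Fin 3 → ℕ} {b : Fin 3}
    (hq : ∀ a, a ≠ b → q a ≤ 1) (I : TreeColoring Q.tree q) : Q = cherryQuilt := by
  have hroot : Q.word 0 = 0 → ¬ Q.tree.left 1 0 := by
    intro h00 hx
    obtain ⟨u, v, hu, hv, hux, hv0, -⟩ := I.exists_children_of_left hq hx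
    obtain ⟨j, rfl⟩ := Q.isWord.surjective b
    have hne : Q.word j ≠ 0 := by
      intro h
      rw [h] at hu
      exact (PlanarTree.not_le_of_left hx).2 (Relation.ReflTransGen.head hu hux)
    have hj : (0 : Fin 4) < j := by
      refine Fin.pos_iff_ne_zero.2 ?_
      rintro rfl
      exact hne h00
    refine Q.not_lt 0 j hj ?_
    rw [h00]
    exact ⟨Relation.ReflTransGen.head hv hv0, hne⟩
  have hnest : ∀ i j k : Fin 4, i < j → j < k → Q.word i = Q.word k → Q.word j ≠ Q.word i →
      Q.tree.left (Q.word j) (Q.word i) := fun i j k h1 h2 h3 h4 =>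
    (Q.left_of i j k h1 h2 h3).resolve_right h4
  rcases word_cases Q.word Q.isWord.nondegenerate Q.isWord.surjective hQ with hW | hW | hW
  · have h21 : Q.tree.left 2 1 := by
      have := hnest 1 2 3 (by decide) (by decide) (by rw [hW]; rfl) (by rw [hW]; decide)
      rwa [hW] at this
    obtain ⟨u, v, hu, hv, hu2, hv1, -⟩ := I.exists_children_of_left hq h21
    have hle := PlanarTree.not_le_of_left h21
    have hb : b = 0 := by
      have h1 : b ≠ 1 := by
        rintro rfl
        exact hle.2 (Relation.ReflTransGen.head hu hu2)
      have h2 : b ≠ 2 := by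
        rintro rfl
        exact hle.1 (Relation.ReflTransGen.head hv hv1)
      omega
    subst hb
    have he2 : Q.tree.edge 0 2 := by
      have h0 : u ≠ 0 := fun h => Q.tree.edge_irrefl 0 (h ▸ hu)
      have h1 : u ≠ 1 := fun h => hle.2 (h ▸ hu2)
      have h2 : u = 2 := by omega
      exact h2 ▸ hu
    have he1 : Q.tree.edge 0 1 := by
      have h0 : v ≠ 0 := fun h => Q.tree.edge_irrefl 0 (h ▸ hv)
      have h1 : v ≠ 2 := fun h => hle.1 (h ▸ hv1)
      have h2 : v = 1 := by omega
      exact h2 ▸ hv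
    have hsingle : ∀ {x y}, Q.tree.edge x y → Q.tree.le x y := Relation.ReflTransGen.single
    have hr : ∀ x, ¬ Q.tree.edge x 0 := by
      intro x hx
      have hx0 : Q.tree.le 0 x := by
        fin_cases x
        exacts [Relation.ReflTransGen.refl, hsingle he1, hsingle he2]
      have := Q.tree.le_antisymm _ _ (hsingle hx) hx0
      subst this
      exact Q.tree.edge_irrefl _ hx
    have hl0 : ∀ x, ¬ Q.tree.left x 0 ∧ ¬ Q.tree.left 0 x := by
      intro x
      have hx0 : Q.tree.le 0 x := by
        fin_cases x
        exacts [Relation.ReflTransGen.refl, hsingle he1, hsingle he2]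
      exact ⟨fun h => (PlanarTree.not_le_of_left h).2 hx0,
        fun h => (PlanarTree.not_le_of_left h).1 hx0⟩
    refine Quilt.ext hW (PlanarTree.ext ?_ ?_)
    · funext x y
      have h12 : ¬ Q.tree.edge 1 2 := fun h => hle.2 (hsingle h)
      have h21 : ¬ Q.tree.edge 2 1 := fun h => hle.1 (hsingle h)
      fin_cases x <;> fin_cases y <;>
        simp [cherryQuilt, cherryTree, hr, he1, he2, h12, h21, Q.tree.edge_irrefl]
    · funext x y
      have h12 : ¬ Q.tree.left 1 2 := fun h =>
        Q.tree.left_irrefl _ (Q.tree.left_trans _ _ _ h h21)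
      fin_cases x <;> fin_cases y <;>
        simp [cherryQuilt, cherryTree, hl0, h21, h12, Q.tree.left_irrefl]
  · refine absurd ?_ (hroot (by rw [hW]; rfl))
    have := hnest 0 1 3 (by decide) (by decide) (by rw [hW]; rfl) (by rw [hW]; decide)
    rwa [hW] at this
  · refine absurd ?_ (hroot (by rw [hW]; rfl))
    have := hnest 0 1 2 (by decide) (by decide) (by rw [hW]; rfl) (by rw [hW]; decide)
    rwa [hW] at this

/-- If all vertices have two arrows and inputs together, and at least one input, then a colored
quilt of arity `d + 2 ≥ 3` is over `[1]`, and a single vertex has two inputs. -/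
theorem Quilt.exists_branching {n d : ℕ} (Q : Quilt n d) (hd : n = d + 2) (hn : 3 ≤ n)
    {p q : Fin n → ℕ} {p' : ℕ} (hpq : ∀ a, p a + q a = 2) (hq : ∀ a, 1 ≤ q a)
    (hp : ∑ a, p a = p' + d) (Z : WordColoring Q.word p p') (I : TreeColoring Q.tree q) :
    p' = 1 ∧ ∃ b, p b = 0 ∧ ∀ a, a ≠ b → p a = 1 := by
  have hp1 : ∀ a, p a ≤ 1 := fun a => by
    have := hpq a
    have := hq a
    omega
  -- The summand `1 - p a` counts the vertices of bidegree (0,2); since `∑ p = p' + n - 2`, there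
  -- are `2 - p'` of them.
  have hsum : ∑ a, p a + ∑ a, (1 - p a) = n := by
    rw [← Finset.sum_add_distrib, Finset.sum_congr rfl (g := fun _ => 1)
      (fun a _ => by have := hp1 a; omega)]
    simp
  have h2 : p' ≤ 2 := by omega
  -- Injectivity of `ζ a`; this excludes `p' = 0`, where all `p a` would vanish although their sum
  -- is `d ≥ 1`.
  have hpp : ∀ a, p a ≤ p' := by
    intro a
    have := Fintype.card_le_of_injective _ (Z.ζ a).injective
    simpa using this
  interval_cases p'
  · have h0 : ∑ a, p a = 0 := Finset.sum_eq_zero fun a _ => Nat.le_zero.1 (hpp a)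
    omega
  · refine ⟨rfl, ?_⟩
    have h1 : ∑ a, (1 - p a) = 1 := by omega
    obtain ⟨b, -, hb⟩ : ∃ b ∈ Finset.univ, 1 - p b ≠ 0 :=
      Finset.exists_ne_zero_of_sum_ne_zero (by omega)
    refine ⟨b, by omega, fun a ha => ?_⟩
    have h2 := Finset.add_le_sum (f := fun a => 1 - p a) (fun _ _ => Nat.zero_le _)
      (Finset.mem_univ a) (Finset.mem_univ b) ha
    have := hp1 a
    omega
  · have h1 : ∑ a, (1 - p a) = 0 := by omega
    rw [Finset.sum_eq_zero_iff] at h1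
    have := Q.arity_le_two hd I (fun a => by
      have := h1 a (Finset.mem_univ _)
      have := hpq a
      omega)
    omega

/-- The ordered word can only be `0 1`; then `1` is not an ancestor of `0`, which leaves one tree.
-/
theorem Quilt.eq_edgeQuilt (Q : Quilt 2 0) (hQ : Q.IsOrdered) :
    Q = edgeQuilt 0 1 (by decide) := by
  have hW : Q.word = ![0, 1] := by
    obtain ⟨i, hi, hi'⟩ := hQ 0 1 (by decide)
    obtain ⟨j, hj⟩ := Q.isWord.surjective 1
    have : ∀ (W : Fin 2 → Fin 2) (i j : Fin 2), W i = 0 → (∀ j ≤ i, W j ≠ 1) → W j = 1 →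
      W = ![0, 1] := by decide
    exact this _ _ _ hi hi' hj
  have h10 : ¬ Q.tree.le 1 0 := by
    intro h
    refine Q.not_lt (0 : Fin 2) (1 : Fin 2) (by decide) ?_
    rw [hW]
    exact ⟨h, by decide⟩
  have hr : Q.tree.root = 0 := PlanarTree.root_eq fun x hx => by
    by_contra hne
    obtain rfl : x = 1 := by omega
    exact h10 hx
  have h01 : Q.tree.edge 0 1 := by
    have h := Q.tree.root_le 1
    rw [hr] at h
    rcases Relation.ReflTransGen.cases_head h with h | ⟨c, hc, -⟩
    · exact absurd h (by decide)
    · have : c ≠ 0 := by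
        rintro rfl
        exact Q.tree.edge_irrefl _ hc
      obtain rfl : c = 1 := by omega
      exact hc
  refine Quilt.ext hW (PlanarTree.ext ?_ ?_)
  · funext x y
    have h10 : ¬ Q.tree.edge 1 0 := fun h => h10 (Relation.ReflTransGen.single h)
    fin_cases x <;> fin_cases y <;>
      simp [edgeQuilt, edgeTree, h01, h10, Q.tree.edge_irrefl]
  · funext x y
    have h01 := Q.tree.root_le 1
    rw [hr] at h01
    have hl : ¬ Q.tree.left 0 1 := fun h => (PlanarTree.not_le_of_left h).1 h01
    have hl' : ¬ Q.tree.left 1 0 := fun h => (PlanarTree.not_le_of_left h).2 h01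
    fin_cases x <;> fin_cases y <;>
      simp [edgeQuilt, edgeTree, hl, hl', Q.tree.left_irrefl]

theorem edgeQuilt_isOrdered : (edgeQuilt 0 1 (by decide)).IsOrdered := by
  simp only [Quilt.IsOrdered, FirstBefore, edgeQuilt]
  decide

/-! ### Reduction of the Maurer-Cartan equation to two quilts -/

section Bicomplex

variable {k : Type t} [Field k] {C : Type u} [Category.{v} C] {A : C ⥤ NUAlg.{t, w} k}

/-- `f` has components only in the bidegrees `(0, 2)` and `(1, 1)`. -/
def IsDeformationCochain (f : TotCochain A) : Prop :=
  ∀ p q : ℕ, p + q ≠ 2 ∨ q = 0 → f p q = 0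

section Composition

variable {n p' q' : ℕ} {T : PlanarTree n} {p q : Fin n → ℕ}

/-- By multilinearity a zero at `x` propagates to each ancestor of `x`. No bound on the depth `m` is
needed, as the default at depth `0` is also zero. -/
theorem evalAt_eq_zero (ζ : ∀ x, Fin (p x + 1) ↪o Fin (p' + 1)) (I : TreeColoring T q)
    (f : ∀ x, Cochain A (p x) (q x)) (φ : Simplex C p')
    (a : Fin q' → A.obj (φ.vertex (Fin.last p'))) {x : Fin n} (hx : f x = 0) :
    ∀ (m : ℕ) (y : Fin n), T.le y x → evalAt ζ I f φ a m y = 0 := by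
  intro m
  induction m with
  | zero => exact fun _ _ => rfl
  | succ m ih =>
    intro y hyx
    rw [evalAt]
    rcases Relation.ReflTransGen.cases_head hyx with rfl | ⟨c, hc, hcx⟩
    · rw [hx]
      rfl
    · have h : ∃ c', ∃ e : T.edge y c', I.slot ⟨(y, c'), e⟩ = I.slot ⟨(y, c), hc⟩ := ⟨c, hc, rfl⟩
      refine (f y (φ.pull (ζ y))).map_coord_zero (I.slot ⟨(y, c), hc⟩) ?_
      refine (dif_pos h).trans ?_
      -- The child chosen in `evalAt` is the given one, because siblings have different labels.
      have hcc : h.choose = c := I.slot_injective _ _ h.choose_spec.choose_spec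
      exact (congrArg _ (ih h.choose (by rw [hcc]; exact hcx))).trans (map_zero _)

theorem composeCochains_eq_zero (ζ : ∀ x, Fin (p x + 1) ↪o Fin (p' + 1)) (I : TreeColoring T q)
    (f : ∀ x, Cochain A (p x) (q x)) {x : Fin n} (hx : f x = 0) :
    composeCochains ζ I f q' = 0 := by
  funext φ a
  rw [composeCochains, evalAt_eq_zero ζ I f φ a hx _ _ (T.root_le x), map_zero]
  rfl

end Composition

variable {n d : ℕ}

/-- A summand with a component outside (0,2) and (1,1) vanishes, so vanishing of the action reduces
to the nonexistence of colorings in the remaining bidegrees. -/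
theorem Quilt.act_eq_zero (Q : Quilt n d) {f : Fin n → TotCochain A}
    (hf : ∀ a, IsDeformationCochain (f a)) (p' q' : ℕ)
    (h : ∀ p q : Fin n → ℕ, (∀ a, p a + q a = 2) → (∀ a, 1 ≤ q a) → ∑ a, p a = p' + d →
      ∑ a, q a = q' + n - 1 → WordColoring Q.word p p' → TreeColoring Q.tree q → False) :
    Q.act f p' q' = 0 := by
  refine Finset.sum_eq_zero fun p hp => Finset.sum_eq_zero fun q hq =>
    Finset.sum_eq_zero fun Z _ => Finset.sum_eq_zero fun I _ => ?_
  rw [Finset.Nat.mem_antidiagonalTuple] at hp hq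
  have hx : ∃ x, f x (p x) (q x) = 0 := by
    by_contra hne
    push Not at hne
    have key : ∀ a, p a + q a = 2 ∧ 1 ≤ q a := by
      intro a
      by_contra hna
      exact hne a (hf a _ _ (by omega))
    exact h p q (fun a => (key a).1) (fun a => (key a).2) hp hq Z I
  obtain ⟨x, hx⟩ := hx
  rw [composeCochains_eq_zero Z.ζ I (fun x => f x (p x) (q x)) hx, smul_zero]

/-- Degree count: `2 n = ∑ p + ∑ q = (p' + d) + (q' + n - 1)` gives `p' + q' = 3`, and `∑ q ≥ n`
gives `q' ≥ 1`. -/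
theorem Quilt.act_eq_zero_of_add_ne (Q : Quilt n d) (hd : n = d + 2) {f : Fin n → TotCochain A}
    (hf : ∀ a, IsDeformationCochain (f a)) {p' q' : ℕ} (h : p' + q' ≠ 3 ∨ q' = 0) :
    Q.act f p' q' = 0 := by
  refine Q.act_eq_zero hf p' q' fun p q hpq hq hp' hq' _ _ => ?_
  have h1 : ∑ a, p a + ∑ a, q a = 2 * n := by
    rw [← Finset.sum_add_distrib, Finset.sum_congr rfl (fun a _ => hpq a)]
    simp [mul_comm]
  have h2 : n ≤ ∑ a, q a := by
    simpa using Finset.sum_le_sum (fun a (_ : a ∈ Finset.univ) => hq a)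
  omega

theorem Quilt.act_eq_zero_of_four_le (Q : Quilt n d) (hd : n = d + 2) (hn : 4 ≤ n)
    {f : Fin n → TotCochain A} (hf : ∀ a, IsDeformationCochain (f a)) : Q.act f = 0 := by
  funext p' q'
  refine Q.act_eq_zero hf p' q' fun p q hpq hq hp' hq' Z I => ?_
  obtain ⟨rfl, b, hb, hb'⟩ := Q.exists_branching hd (by omega) hpq hq hp' Z I
  have := Q.arity_le_three hd hb hb' (by have := hpq b; omega)
    (fun a ha => by have := hpq a; have := hb' a ha; omega) Z I
  omega

theorem Quilt.act_eq_zero_of_ne (Q : Quilt 3 1) (hQ : Q.IsOrdered) (hne : Q ≠ cherryQuilt)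
    {f : Fin 3 → TotCochain A} (hf : ∀ a, IsDeformationCochain (f a)) : Q.act f = 0 := by
  funext p' q'
  refine Q.act_eq_zero hf p' q' fun p q hpq hq hp' hq' Z I => ?_
  obtain ⟨rfl, b, hb, hb'⟩ := Q.exists_branching rfl le_rfl hpq hq hp' Z I
  exact hne (Q.eq_cherryQuilt hQ (fun a ha => by have := hpq a; have := hb' a ha; omega) I)

open Classical in
theorem opP0_two (f : Fin 2 → TotCochain A) :
    opP0 2 f = (edgeQuilt 0 1 (by decide)).act f := by
  have : Finset.univ.filter (fun Q : Quilt 2 (2 - 2) => Q.IsOrdered) =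
      {edgeQuilt 0 1 (by decide)} := by
    ext Q
    simp only [Finset.mem_filter, Finset.mem_univ, true_and, Finset.mem_singleton]
    exact ⟨fun h => Q.eq_edgeQuilt h, fun h => h ▸ edgeQuilt_isOrdered⟩
  rw [opP0, this, Finset.sum_singleton]
  -- The sign is `(-1)^(1 + 1) = 1`.
  norm_num

open Classical in
theorem opP0_three {f : Fin 3 → TotCochain A} (hf : ∀ a, IsDeformationCochain (f a)) :
    opP0 3 f = cherryQuilt.act f := by
  rw [opP0, Finset.sum_eq_single (cherryQuilt : Quilt 3 (3 - 2))]
  -- The sign is `(-1)^(1 + 3) = 1`.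
  · norm_num
  · intro Q hQ hne
    exact Quilt.act_eq_zero_of_ne Q (Finset.mem_filter.1 hQ).2 hne hf
  · intro h
    exact absurd (Finset.mem_filter.2 ⟨Finset.mem_univ _, cherryQuilt_isOrdered⟩) h

theorem opP0_eq_zero (hn : 4 ≤ n) {f : Fin n → TotCochain A}
    (hf : ∀ a, IsDeformationCochain (f a)) : opP0 n f = 0 := by
  rw [opP0, Finset.sum_eq_zero, smul_zero]
  exact fun Q _ => Q.act_eq_zero_of_four_le (by omega) hn hf

theorem isDeformationCochain_mulCochain : IsDeformationCochain (mulCochain A) := by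
  rintro (_ | p) (_ | _ | _ | q) h
  all_goals first | rfl | omega

theorem isDeformationCochain_cons {f : TotCochain A} (hf : IsDeformationCochain f) :
    ∀ a : Fin (n + 1), IsDeformationCochain
      ((Fin.cons (mulCochain A) (fun _ : Fin n => f) : Fin (n + 1) → TotCochain A) a) :=
  Fin.cases isDeformationCochain_mulCochain fun _ => hf

theorem opP_two {f : TotCochain A} (hf : IsDeformationCochain f) :
    opP 2 (fun _ => f) = (edgeQuilt 0 1 (by decide)).act (fun _ => f) +
      cherryQuilt.act (Fin.cons (mulCochain A) (fun _ => f)) := by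
  rw [opP, opP0_two, opP0_three (isDeformationCochain_cons hf)]

theorem opP_three {f : TotCochain A} (hf : IsDeformationCochain f) :
    opP 3 (fun _ => f) = cherryQuilt.act (fun _ => f) := by
  rw [opP, opP0_three (fun _ => hf), opP0_eq_zero le_rfl (isDeformationCochain_cons hf), add_zero]

theorem opP_eq_zero {f : TotCochain A} (hf : IsDeformationCochain f) (hn : 4 ≤ n) :
    opP n (fun _ => f) = 0 := by
  rw [opP, opP0_eq_zero hn (fun _ => hf), opP0_eq_zero (by omega) (isDeformationCochain_cons hf),
    add_zero]

theorem isMaurerCartan_iff {f : TotCochain A} (hf : IsDeformationCochain f) :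
    IsMaurerCartan f ↔ deltaS f + deltaH f + (opP 2 (fun _ => f) + opP 3 (fun _ => f)) = 0 := by
  have hsub : {n : ℕ | 2 ≤ n ∧ opP n (fun _ => f) ≠ 0} ⊆ ({2, 3} : Finset ℕ) := by
    rintro n ⟨h2, h⟩
    have : ¬ 4 ≤ n := fun h4 => h (opP_eq_zero hf h4)
    simp
    omega
  have hsum : ∑ᶠ (n : ℕ) (_ : 2 ≤ n), opP n (fun _ => f) =
      opP 2 (fun _ => f) + opP 3 (fun _ => f) := by
    rw [← Finset.sum_pair (f := fun n => opP n (fun _ => f)) (show 2 ≠ 3 by decide)]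
    -- One of the terms for `n = 2, 3` may vanish too, so the index sets are compared only after
    -- intersection with the support.
    refine finsum_mem_eq_sum_of_inter_support_eq (s := {n : ℕ | 2 ≤ n}) _ ?_
    ext n
    constructor
    · exact fun h => ⟨hsub h, h.2⟩
    · rintro ⟨h, h'⟩
      refine ⟨?_, h'⟩
      simp only [Finset.coe_insert, Finset.coe_singleton, Set.mem_insert_iff,
        Set.mem_singleton_iff] at h
      exact show 2 ≤ n by omega
  rw [IsMaurerCartan, hsum]
  exact and_iff_right ((Finset.finite_toSet _).subset hsub)

end Bicomplex

/-! ### Colorings of the one-edge quilts -/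

/-- A strictly increasing map gains at least one at each step. Where the target leaves no slack,
this determines the map. -/
theorem orderEmb_add_le {m N : ℕ} (ζ : Fin (m + 1) ↪o Fin (N + 1)) :
    ∀ (d : ℕ) (i j : Fin (m + 1)), (j : ℕ) = i + d → (ζ i : ℕ) + d ≤ ζ j := by
  intro d
  induction d with
  | zero =>
    intro i j h
    obtain rfl : i = j := Fin.ext h.symm
    exact le_rfl
  | succ d ih =>
    intro i j h
    have h1 := ih i ⟨i + d, by omega⟩ rfl
    have h2 : ζ ⟨i + d, by omega⟩ < ζ j := ζ.lt_iff_lt.2 (Fin.lt_def.2 (by simp; omega))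
    have h3 := Fin.lt_def.1 h2
    omega

section EdgeQuilt

variable {r c : Fin 2} {p q : Fin 2 → ℕ} {p' : ℕ}

/-- The maps of the word coloring of the word `r c`. -/
def edgeZeta (h : r ≠ c) (hp : p' = p r + p c) (a : Fin 2) : Fin (p a + 1) ↪o Fin (p' + 1) :=
  OrderEmbedding.ofStrictMono
    -- The letter `r` fills `[0, p r]` and `c` fills `[p r, p']`; they share the point `p r`.
    (fun i => ⟨i + if a = r then 0 else p r, by
      have : a = r ∨ a = c := by omega
      rcases this with rfl | rfl
      · simp
        omega
      · simp [h.symm]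
        omega⟩)
    (fun i j hij => by
      have := Fin.lt_def.1 hij
      simpa using this)

theorem edgeZeta_val (h : r ≠ c) (hp : p' = p r + p c) (a : Fin 2) (i : Fin (p a + 1)) :
    (edgeZeta h hp a i : ℕ) = i + if a = r then 0 else p r := rfl

theorem ordConnected_range_edgeZeta (h : r ≠ c) (hp : p' = p r + p c) (a : Fin 2) :
    (Set.range (edgeZeta h hp a)).OrdConnected := by
  refine ⟨?_⟩
  rintro _ ⟨x, rfl⟩ _ ⟨y, rfl⟩ z ⟨hxz, hzy⟩
  rw [Fin.le_def, edgeZeta_val] at hxz hzy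
  refine ⟨⟨z - if a = r then 0 else p r, by omega⟩, ?_⟩
  ext
  rw [edgeZeta_val]
  simp only
  omega

/-- The word coloring of the word `r c`. -/
def edgeWordColoring (h : r ≠ c) (hp : p' = p r + p c) :
    WordColoring (edgeQuilt r c h).word p p' where
  ζ := edgeZeta h hp
  cover j := by
    by_cases hj : (j : ℕ) ≤ p r
    · exact ⟨r, ⟨j, by omega⟩, by ext; simp [edgeZeta_val]⟩
    · refine ⟨c, ⟨j - p r, by omega⟩, ?_⟩
      ext
      simp [edgeZeta_val, h.symm]
      omega
  exists_pi := by
    have hpre : ∀ i : Fin 2, (fun _ : Fin (p ((edgeQuilt r c h).word i) + 1) =>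
        if (edgeQuilt r c h).word i = r then (0 : Fin 2) else (1 : Fin 2)) ⁻¹' {i} = Set.univ := by
      refine Fin.forall_fin_two.2 ⟨?_, ?_⟩ <;> simp [edgeQuilt, h.symm]
    refine ⟨fun a _ => if a = r then (0 : Fin 2) else (1 : Fin 2), ?_, ?_, ?_⟩
    · intro a
      ext i
      have : a = r ∨ a = c := by omega
      rcases this with rfl | rfl <;> revert i <;> refine Fin.forall_fin_two.2 ⟨?_, ?_⟩ <;>
        simp [edgeQuilt, h, h.symm]
    · intro i
      refine (congrArg (fun S => (edgeZeta h hp _ '' S).OrdConnected) (hpre i)).mpr ?_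
      rw [Set.image_univ]
      exact ordConnected_range_edgeZeta h hp _
    · have key : ∃ m, IsGreatest (edgeZeta h hp r '' Set.univ) m ∧
          IsLeast (edgeZeta h hp c '' Set.univ) m := by
        refine ⟨⟨p r, by omega⟩, ⟨⟨Fin.last _, trivial, ?_⟩, ?_⟩, ⟨⟨0, trivial, ?_⟩, ?_⟩⟩
        · ext
          simp [edgeZeta_val]
        · rintro _ ⟨x, -, rfl⟩
          have := x.2
          simp only [Fin.le_def, edgeZeta_val, if_true]
          omega
        · ext
          simp [edgeZeta_val, h.symm]
        · rintro _ ⟨x, -, rfl⟩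
          simp [Fin.le_def, edgeZeta_val, h.symm]
      have h0 := hpre 0
      have h1 := hpre 1
      refine Fin.forall_fin_two.2 ⟨?_, ?_⟩ <;> refine Fin.forall_fin_two.2 ⟨?_, ?_⟩ <;> intro hij
      all_goals first | (exfalso; revert hij; decide) | skip
      obtain ⟨m, hm, hm'⟩ := key
      refine ⟨m, ?_, ?_⟩
      · exact (congrArg (fun S => IsGreatest (edgeZeta h hp r '' S) m) h0).mpr hm
      · exact (congrArg (fun S => IsLeast (edgeZeta h hp c '' S) m) h1).mpr hm'

theorem edgeWordColoring_zeta (h : r ≠ c) (hp : p' = p r + p c) (a : Fin 2) (i : Fin (p a + 1)) :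
    ((edgeWordColoring h hp).ζ a i : ℕ) = i + if a = r then 0 else p r := rfl

/-- The image of `ζ c` starts no earlier than that of `ζ r` ends, and `p' = p r + p c` leaves no gap
anywhere. -/
theorem eq_edgeWordColoring (h : r ≠ c) (hp : p' = p r + p c)
    (Z : WordColoring (edgeQuilt r c h).word p p') : Z = edgeWordColoring h hp := by
  obtain ⟨π, hπ⟩ := Z.exists_pi
  have hle : Z.ζ r (Fin.last _) ≤ Z.ζ c 0 := by
    refine hπ.zeta_le_of_pi_lt ?_
    have h1 := hπ.word_pi r (Fin.last _)
    have h2 := hπ.word_pi c 0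
    generalize π r (Fin.last _) = i at h1 ⊢
    generalize π c 0 = j at h2 ⊢
    revert i j
    refine Fin.forall_fin_two.2 ⟨?_, ?_⟩ <;> intro h1 <;> refine Fin.forall_fin_two.2 ⟨?_, ?_⟩ <;>
      intro h2
    · exact absurd h2 h
    · exact (by decide : (0 : Fin 2) < 1)
    · exact absurd h1.symm h
    · exact absurd h1.symm h
  have hle := Fin.le_def.1 hle
  have e1 : ∀ i : Fin (p r + 1), (Z.ζ r i : ℕ) + (p r - i) ≤ Z.ζ r (Fin.last _) := fun i =>
    orderEmb_add_le _ _ _ _ (by simp; omega)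
  have e2 : ∀ i : Fin (p c + 1), (Z.ζ c 0 : ℕ) + i ≤ Z.ζ c i := fun i =>
    orderEmb_add_le _ _ _ _ (by simp)
  have e3 : ∀ i : Fin (p c + 1), (Z.ζ c i : ℕ) + (p c - i) ≤ Z.ζ c (Fin.last _) := fun i =>
    orderEmb_add_le _ _ _ _ (by simp; omega)
  have e4 : ∀ i : Fin (p r + 1), (Z.ζ r 0 : ℕ) + i ≤ Z.ζ r i := fun i =>
    orderEmb_add_le _ _ _ _ (by simp)
  have e5 := (Z.ζ c (Fin.last _)).2
  refine WordColoring.ext ?_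
  funext a
  ext i
  rw [edgeWordColoring_zeta]
  have : a = r ∨ a = c := by omega
  rcases this with rfl | rfl
  · have h1 := e1 i
    have h2 := e4 i
    have h3 := e3 0
    have := i.2
    simp at h3 ⊢
    omega
  · have h1 := e3 i
    have h2 := e2 i
    have h3 := e4 (Fin.last _)
    have := i.2
    simp [h.symm] at h3 ⊢
    omega

/-- The coloring of the tree with one edge by `s`. -/
def edgeColoring (h : r ≠ c) (s : Fin (q r)) : TreeColoring (edgeTree r c h) q where
  slot e := Fin.cast (congrArg q e.2.1.symm) s
  slot_lt _ _ _ _ _ hl := hl.elim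

theorem sum_edgeColoring {M : Type*} [AddCommMonoid M] (h : r ≠ c)
    (g : TreeColoring (edgeTree r c h) q → M) : ∑ I, g I = ∑ s, g (edgeColoring h s) := by
  refine (Fintype.sum_bijective (edgeColoring h) ⟨?_, ?_⟩ _ _ fun _ => rfl).symm
  · intro s s' hs
    exact congrArg (fun I : TreeColoring (edgeTree r c h) q => I.slot ⟨(r, c), rfl, rfl⟩) hs
  · intro I
    refine ⟨I.slot ⟨(r, c), rfl, rfl⟩, TreeColoring.ext ?_⟩
    funext ⟨⟨x, y⟩, hx, hy⟩
    simp only at hx hy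
    subst hx hy
    rfl

/-- The order of the inputs of a tree with one edge that is colored by `s`. -/
abbrev EdgeInputBefore (r c : Fin 2) (s : ℕ) (x : Fin 2) (i : ℕ) (y : Fin 2) (j : ℕ) : Prop :=
  (x = y ∧ i < j) ∨ (x = r ∧ y = c ∧ i < s) ∨ (y = r ∧ x = c ∧ s ≤ j)

/-- The right side mentions neither edges nor the generated order and is decidable, so that signs
and positions of inputs can be computed. -/
theorem inputBefore_edgeColoring (h : r ≠ c) (s : Fin (q r)) (x : Fin 2) (i : ℕ) (y : Fin 2)
    (j : ℕ) :
    InputBefore (edgeTree r c h) (fun e => ((edgeColoring h s).slot e : ℕ)) x i y j ↔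
      EdgeInputBefore r c s x i y j := by
  have hle : ∀ z, (edgeTree r c h).le c z ↔ z = c := by
    intro z
    refine (edge_reflTransGen h).trans ?_
    simp [h.symm, eq_comm]
  constructor
  · rintro (h1 | h1 | ⟨d, ⟨hx, hd⟩, hy, hi⟩ | ⟨d, ⟨hx, hd⟩, hy, hi⟩)
    · exact Or.inl h1
    · exact h1.elim
    · subst hd
      exact Or.inr (Or.inl ⟨hx, (hle _).1 hy, hi⟩)
    · subst hd
      exact Or.inr (Or.inr ⟨hx, (hle _).1 hy, hi⟩)
  · rintro (h1 | ⟨hx, hy, hi⟩ | ⟨hx, hy, hi⟩)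
    · exact Or.inl h1
    · exact Or.inr (Or.inr (Or.inl ⟨c, ⟨hx, rfl⟩, (hle _).2 hy, hi⟩))
    · exact Or.inr (Or.inr (Or.inr ⟨c, ⟨hx, rfl⟩, (hle _).2 hy, hi⟩))

theorem isFree_edgeColoring (h : r ≠ c) (s : Fin (q r)) (x : Fin 2) (i : Fin (q x)) :
    (edgeColoring h s).IsFree x i ↔ ¬ (x = r ∧ (i : ℕ) = s) := by
  refine not_congr ⟨?_, ?_⟩
  · rintro ⟨d, ⟨hx, hd⟩, hi⟩
    exact ⟨hx, by rw [← hi]; rfl⟩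
  · rintro ⟨rfl, hi⟩
    exact ⟨c, ⟨rfl, rfl⟩, Fin.ext hi.symm⟩

theorem inputIndex_edgeColoring (h : r ≠ c) (s : Fin (q r)) (x : Fin 2) (i : Fin (q x)) :
    (edgeColoring h s).inputIndex x i = (Finset.univ.filter (fun t : Σ y, Fin (q y) =>
      ¬ (t.1 = r ∧ (t.2 : ℕ) = s) ∧ EdgeInputBefore r c s t.1 t.2 x i)).card := by
  rw [TreeColoring.inputIndex]
  congr 1
  ext t
  simp only [Finset.mem_filter, isFree_edgeColoring, inputBefore_edgeColoring]

end EdgeQuilt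

/-! ### Signs as decidable inversion counts -/

section Sign

variable {n L : ℕ}

instance (W : Fin L → Fin n) : DecidablePred (Interposed W) := fun x =>
  inferInstanceAs (Decidable (∃ i j k : Fin L, (j : ℕ) = i + 1 ∧ j < k ∧ W j = x ∧ W i = W k))

instance (W : Fin L → Fin n) : DecidableRel (FirstBefore W) := fun x y =>
  inferInstanceAs (Decidable (∃ i : Fin L, W i = x ∧ ∀ j : Fin L, j ≤ i → W j ≠ y))

instance (W : Fin L → Fin n) (p : Fin n → ℕ) : DecidablePred (Degenerate W p) := fun a =>
  inferInstanceAs (Decidable (Interposed W a ∧ p a = 0))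

instance {p q : Fin n → ℕ} : DecidableRel (InitialBefore (p := p) (q := q))
  | .inl x, .inl y => inferInstanceAs (Decidable (x.1 < y.1 ∨ (x.1 = y.1 ∧ (x.2 : ℕ) < y.2)))
  | .inl x, .inr y => inferInstanceAs (Decidable (x.1 ≤ y.1))
  | .inr x, .inl y => inferInstanceAs (Decidable (x.1 < y.1))
  | .inr x, .inr y => inferInstanceAs (Decidable (x.1 < y.1 ∨ (x.1 = y.1 ∧ (x.2 : ℕ) < y.2)))

/-- `ShuffledBefore` for a given order of the inputs. -/
def ShuffledBeforeOf (W : Fin L → Fin n) (ib : Fin n → ℕ → Fin n → ℕ → Prop)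
    (pos : Fin n → ℕ → ℕ) {p q : Fin n → ℕ} : SLetter p q → SLetter p q → Prop
  | .inl x, .inl y =>
      (((x.2 : ℕ) = 0 ∧ Interposed W x.1) ∧ ((y.2 : ℕ) = 0 ∧ Interposed W y.1) ∧
        FirstBefore W y.1 x.1) ∨
      (((x.2 : ℕ) = 0 ∧ Interposed W x.1) ∧ ¬ ((y.2 : ℕ) = 0 ∧ Interposed W y.1)) ∨
      (¬ ((x.2 : ℕ) = 0 ∧ Interposed W x.1) ∧ ¬ ((y.2 : ℕ) = 0 ∧ Interposed W y.1) ∧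
        pos x.1 x.2 < pos y.1 y.2)
  | .inl _, .inr _ => True
  | .inr _, .inl _ => False
  | .inr x, .inr y => ib x.1 x.2 y.1 y.2

instance (W : Fin L → Fin n) (ib : Fin n → ℕ → Fin n → ℕ → Prop)
    [∀ x i y j, Decidable (ib x i y j)] (pos : Fin n → ℕ → ℕ) {p q : Fin n → ℕ} :
    DecidableRel (ShuffledBeforeOf W ib pos (p := p) (q := q))
  | .inl x, .inl y => by
    unfold ShuffledBeforeOf
    infer_instance
  | .inl _, .inr _ => .isTrue trivial
  | .inr _, .inl _ => .isFalse id
  | .inr x, .inr y => inferInstanceAs (Decidable (ib x.1 x.2 y.1 y.2))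

/-- Without degenerate vertices and nullary cochains all corrections vanish. In particular the
noncomputable `Z.pi` drops out, and `decide` can evaluate the count. -/
theorem coloringSign_eq {W : Fin L → Fin n} {T : PlanarTree n} {p q : Fin n → ℕ} {p' : ℕ}
    (Z : WordColoring W p p') (I : TreeColoring T q) (hp : ∀ a, ¬ Degenerate W p a)
    (hq : ∀ a, q a ≠ 0) {ib : Fin n → ℕ → Fin n → ℕ → Prop} [∀ x i y j, Decidable (ib x i y j)]
    (hib : ∀ x i y j, InputBefore T (fun e => (I.slot e : ℕ)) x i y j ↔ ib x i y j) :
    coloringSign Z I = (-1) ^ (Finset.univ.filter (fun z : SLetter p q × SLetter p q =>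
      InitialBefore z.1 z.2 ∧ ShuffledBeforeOf W ib
        (fun a i => (Z.ζ a (Fin.ofNat (p a + 1) i) : ℕ)) z.2 z.1)).card := by
  classical
  have hsh : ∀ (pos : Fin n → ℕ → ℕ) (z z' : SLetter p q),
      ShuffledBefore W T (fun e => (I.slot e : ℕ)) pos z z' ↔ ShuffledBeforeOf W ib pos z z' := by
    rintro pos (x | x) (y | y)
    · exact Iff.rfl
    · exact Iff.rfl
    · exact Iff.rfl
    · exact hib _ _ _ _
  simp only [coloringSign, hp, hq, if_false, false_and, Finset.filter_false, Finset.card_empty,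
    mul_zero, add_zero]
  unfold shuffleSign
  congr 2
  ext z
  simp only [Finset.mem_filter, hsh]

end Sign

/-! ### Evaluation of compositions on simplices -/

section Bicomplex

variable {k : Type t} [Field k] {C : Type u} [Category.{v} C] {A : C ⥤ NUAlg.{t, w} k}

/-- Every 0-simplex comes from an object, so pulled-back simplices can be treated as objects. -/
theorem binaryPart_vertex (f : TotCochain A) (ψ : Simplex C 0)
    (v : Fin 2 → A.obj (ψ.vertex (Fin.last 0))) :
    f 0 2 ψ v = binaryPart f (ψ.vertex 0) (v 0) (v 1) := by
  obtain ⟨X, rfl⟩ := ComposableArrows.mk₀_surjective ψ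
  refine congrArg (f 0 2 (ComposableArrows.mk₀ X)) ?_
  funext i
  revert i
  exact Fin.forall_fin_two.2 ⟨rfl, rfl⟩

theorem unaryPart_arrow (f : TotCochain A) (ψ : Simplex C 1)
    (v : Fin 1 → A.obj (ψ.vertex (Fin.last 1))) :
    f 1 1 ψ v = unaryPart f (ψ.arrow (Fin.zero_le (1 : Fin 2))) (v 0) := by
  obtain ⟨X, Y, g, rfl⟩ := ComposableArrows.mk₁_surjective ψ
  refine congrArg (f 1 1 (ComposableArrows.mk₁ g)) ?_
  funext i
  rw [Subsingleton.elim i 0]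
  rfl

theorem trans_of_le {p : ℕ} (φ : Simplex C p) {i j : Fin (p + 1)} (h : i ≤ j)
    (a : A.obj (φ.vertex j)) : trans A φ i j a = algMap A (φ.arrow h) a := by
  rw [trans, dif_pos h]
  rfl

theorem algMap_id (x : C) (a : A.obj x) : algMap A (𝟙 x) a = a := by
  have := A.map_id x
  exact congrArg (fun g : A.obj x →ₙₐ[k] A.obj x => g a) this

theorem algMap_comp {x y z : C} (φ : x ⟶ y) (ψ : y ⟶ z) (a : A.obj x) :
    algMap A (φ ≫ ψ) a = algMap A ψ (algMap A φ a) := by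
  have := A.map_comp φ ψ
  exact congrArg (fun g : A.obj x →ₙₐ[k] A.obj z => g a) this

theorem trans_self {p : ℕ} (φ : Simplex C p) (i : Fin (p + 1)) (a : A.obj (φ.vertex i)) :
    trans A φ i i a = a := by
  rw [trans_of_le φ le_rfl]
  have : φ.arrow (le_refl i) = 𝟙 _ := by
    have : homOfLE (le_refl i) = 𝟙 i := rfl
    rw [Simplex.arrow, this, φ.map_id]
    rfl
  rw [this, algMap_id]

/-- Counterpart of `Quilt.act_eq_zero` for nonzero actions: `S` lists all bidegrees of the arguments
that can contribute. -/
theorem Quilt.act_apply {n d : ℕ} (Q : Quilt n d) {f : Fin n → TotCochain A}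
    (hf : ∀ a, IsDeformationCochain (f a)) (p' q' : ℕ) (S : Finset ((Fin n → ℕ) × (Fin n → ℕ)))
    (hS : ∀ s ∈ S, ∑ a, s.1 a = p' + d ∧ ∑ a, s.2 a = q' + n - 1)
    (h : ∀ p q : Fin n → ℕ, (∀ a, p a + q a = 2) → (∀ a, 1 ≤ q a) → ∑ a, p a = p' + d →
      ∑ a, q a = q' + n - 1 → WordColoring Q.word p p' → TreeColoring Q.tree q → (p, q) ∈ S) :
    Q.act f p' q' = ∑ s ∈ S, ∑ Z : WordColoring Q.word s.1 p', ∑ I : TreeColoring Q.tree s.2,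
      coloringSign Z I • composeCochains Z.ζ I (fun x => f x (s.1 x) (s.2 x)) q' := by
  rw [Quilt.act, ← Finset.sum_product']
  refine (Finset.sum_subset (fun s hs => ?_) fun s hs hsS => ?_).symm
  · rw [Finset.mem_product, Finset.Nat.mem_antidiagonalTuple, Finset.Nat.mem_antidiagonalTuple]
    exact hS s hs
  · rw [Finset.mem_product, Finset.Nat.mem_antidiagonalTuple,
      Finset.Nat.mem_antidiagonalTuple] at hs
    refine Finset.sum_eq_zero fun Z _ => Finset.sum_eq_zero fun I _ => ?_
    obtain ⟨x, hx⟩ : ∃ x, f x (s.1 x) (s.2 x) = 0 := by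
      by_contra hne
      push Not at hne
      have key : ∀ a, s.1 a + s.2 a = 2 ∧ 1 ≤ s.2 a := by
        intro a
        by_contra hna
        exact hne a (hf a _ _ (by omega))
      exact hsS (h s.1 s.2 (fun a => (key a).1) (fun a => (key a).2) hs.1 hs.2 Z I)
    rw [composeCochains_eq_zero Z.ζ I (fun x => f x (s.1 x) (s.2 x)) hx, smul_zero]

section Composition

variable {n p' q' : ℕ} {T : PlanarTree n} {p q : Fin n → ℕ}

/-- Eliminates the choice of children in `evalAt`: an explicit tuple `v` is enough, once it is
checked at the edges and at the free inputs. -/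
theorem evalAt_succ (ζ : ∀ x, Fin (p x + 1) ↪o Fin (p' + 1)) (I : TreeColoring T q)
    (f : ∀ x, Cochain A (p x) (q x)) (φ : Simplex C p')
    (a : Fin q' → A.obj (φ.vertex (Fin.last p'))) (m : ℕ) (x : Fin n)
    (v : Fin (q x) → A.obj (φ.vertex (ζ x (Fin.last (p x)))))
    (hedge : ∀ c (e : T.edge x c), v (I.slot ⟨(x, c), e⟩) =
      trans A φ (ζ x (Fin.last (p x))) (ζ c 0) (evalAt ζ I f φ a m c))
    (hfree : ∀ i, I.IsFree x i → ∃ j : Fin q', I.inputIndex x i = j ∧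
      v i = trans A φ (ζ x (Fin.last (p x))) (Fin.last p') (a j)) :
    evalAt ζ I f φ a (m + 1) x = f x (φ.pull (ζ x)) v := by
  rw [evalAt]
  refine congrArg (f x (φ.pull (ζ x))) ?_
  funext i
  by_cases h : ∃ c, ∃ e : T.edge x c, I.slot ⟨(x, c), e⟩ = i
  · refine (dif_pos h).trans ?_
    rw [← hedge h.choose h.choose_spec.choose, h.choose_spec.choose_spec]
  · refine (dif_neg h).trans ?_
    obtain ⟨j, hj, hv⟩ := hfree i h
    rw [hv]
    refine congrArg _ ?_
    rw [dif_pos (by omega)]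
    exact congrArg a (Fin.ext hj)

theorem composeCochains_eq (ζ : ∀ x, Fin (p x + 1) ↪o Fin (p' + 1)) (I : TreeColoring T q)
    (f : ∀ x, Cochain A (p x) (q x)) (φ : Simplex C p')
    (a : Fin q' → A.obj (φ.vertex (Fin.last p'))) {r : Fin n} (hr : T.root = r) :
    composeCochains ζ I f q' φ a = trans A φ 0 (ζ r 0) (evalAt ζ I f φ a n r) := by
  subst hr
  rfl

end Composition

section EdgeQuilt

variable {r c : Fin 2} {p q : Fin 2 → ℕ} {p' q' : ℕ}

theorem edgeTree_root (h : r ≠ c) : (edgeTree r c h).root = r :=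
  PlanarTree.root_eq fun x hx => by
    rcases (edge_reflTransGen h).1 hx with h1 | h1
    · exact h1
    · exact h1.1

theorem composeCochains_edgeColoring (h : r ≠ c) (ζ : ∀ x, Fin (p x + 1) ↪o Fin (p' + 1))
    (s : Fin (q r)) (f : ∀ x, Cochain A (p x) (q x)) (φ : Simplex C p')
    (a : Fin q' → A.obj (φ.vertex (Fin.last p')))
    (v : Fin (q r) → A.obj (φ.vertex (ζ r (Fin.last (p r)))))
    (w : Fin (q c) → A.obj (φ.vertex (ζ c (Fin.last (p c)))))
    (hs : v s = trans A φ (ζ r (Fin.last (p r))) (ζ c 0) (f c (φ.pull (ζ c)) w))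
    (hv : ∀ i, i ≠ s → ∃ j : Fin q', (edgeColoring h s).inputIndex r i = j ∧
      v i = trans A φ (ζ r (Fin.last (p r))) (Fin.last p') (a j))
    (hw : ∀ i, ∃ j : Fin q', (edgeColoring h s).inputIndex c i = j ∧
      w i = trans A φ (ζ c (Fin.last (p c))) (Fin.last p') (a j)) :
    composeCochains ζ (edgeColoring h s) f q' φ a =
      trans A φ 0 (ζ r 0) (f r (φ.pull (ζ r)) v) := by
  rw [composeCochains_eq ζ _ f φ a (edgeTree_root h)]
  -- The depth `n = 2` pays for one step at `r` and one at `c`.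
  refine congrArg _ (evalAt_succ ζ _ f φ a 1 r v ?_ ?_)
  · rintro d ⟨-, hd⟩
    subst hd
    refine hs.trans (congrArg _ (evalAt_succ ζ _ f φ a 0 d w ?_ fun i _ => hw i).symm)
    rintro d' ⟨hd', -⟩
    exact absurd hd'.symm h
  · intro i hi
    refine hv i ?_
    rintro rfl
    exact hi ⟨c, ⟨rfl, rfl⟩, rfl⟩

theorem sum_edgeQuilt (h : r ≠ c) (hp : p' = p r + p c) (f : ∀ x, Cochain A (p x) (q x)) :
    ∑ Z : WordColoring (edgeQuilt r c h).word p p', ∑ I : TreeColoring (edgeQuilt r c h).tree q,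
      coloringSign Z I • composeCochains Z.ζ I f q' =
    ∑ s : Fin (q r), coloringSign (edgeWordColoring h hp) (edgeColoring h s) •
      composeCochains (edgeZeta h hp) (edgeColoring h s) f q' := by
  have : Subsingleton (WordColoring (edgeQuilt r c h).word p p') :=
    ⟨fun Y Z => (eq_edgeWordColoring h hp Y).trans (eq_edgeWordColoring h hp Z).symm⟩
  rw [Fintype.sum_subsingleton _ (edgeWordColoring h hp)]
  exact sum_edgeColoring h _

theorem coloringSign_edge (h : r ≠ c) (hp : p' = p r + p c) (hq : ∀ x, q x ≠ 0) (s : Fin (q r)) :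
    coloringSign (edgeWordColoring h hp) (edgeColoring h s) =
      (-1) ^ (Finset.univ.filter (fun z : SLetter p q × SLetter p q =>
      InitialBefore z.1 z.2 ∧ ShuffledBeforeOf ![r, c] (EdgeInputBefore r c s)
        (fun a i => (edgeZeta h hp a (Fin.ofNat (p a + 1) i) : ℕ)) z.2 z.1)).card := by
  refine coloringSign_eq (edgeWordColoring h hp) (edgeColoring h s) ?_ hq
    (inputBefore_edgeColoring h s)
  -- An interposed letter needs three positions, and the word has two.
  rintro a ⟨⟨i, j, l, hij, hjl, -⟩, -⟩
  have := Fin.lt_def.1 hjl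
  omega

end EdgeQuilt

end Bicomplex

/-! ### The action of the one-edge quilts -/

theorem pair_cases {r c : Fin 2} (h : r ≠ c) : (r = 0 ∧ c = 1) ∨ (r = 1 ∧ c = 0) := by
  omega

/-- The sign `1` if `r = 0`, and `-1` if `r = 1`. -/
abbrev rootSign (r : Fin 2) : ℤ := if r = 0 then 1 else -1

/-- The function on `Fin 2` with the value `i` at `r` and `j` at the other element. -/
abbrev pairFun (r : Fin 2) (i j : ℕ) : Fin 2 → ℕ := fun x => if x = r then i else j

section EdgeQuilt

variable {r c : Fin 2}

theorem pairFun_self (r : Fin 2) (i j : ℕ) : pairFun r i j r = i := if_pos rfl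

theorem pairFun_of_ne (h : r ≠ c) (i j : ℕ) : pairFun r i j c = j := if_neg h.symm

theorem eq_pairFun (h : r ≠ c) {p : Fin 2 → ℕ} {i j : ℕ} (hr : p r = i) (hc : p c = j) :
    p = pairFun r i j := by
  funext x
  rcases (by omega : x = r ∨ x = c) with rfl | rfl
  · rw [pairFun_self, hr]
  · rw [pairFun_of_ne h, hc]

theorem sum_pair_eq {M : Type*} [AddCommMonoid M] (h : r ≠ c) (p : Fin 2 → M) :
    ∑ a, p a = p r + p c := by
  rw [Fin.sum_univ_two]
  rcases pair_cases h with ⟨rfl, rfl⟩ | ⟨rfl, rfl⟩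
  · rfl
  · exact add_comm _ _

theorem sum_fin_of_eq_one {M : Type*} [AddCommMonoid M] {m : ℕ} (hm : m = 1) (g : Fin m → M) :
    ∑ s, g s = g ⟨0, by omega⟩ := by
  subst hm
  exact Fin.sum_univ_one g

theorem sum_fin_of_eq_two {M : Type*} [AddCommMonoid M] {m : ℕ} (hm : m = 2) (g : Fin m → M) :
    ∑ s, g s = g ⟨0, by omega⟩ + g ⟨1, by omega⟩ := by
  subst hm
  exact Fin.sum_univ_two g

/-- Each vertex has one horizontal letter. With `c` in the first input, the letter of `c` precedes
that of `r`; with `c` in the second input it follows. -/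
theorem coloringSign_zero_three_left (h : r ≠ c) (hp : 0 = pairFun r 0 0 r + pairFun r 0 0 c)
    (s : Fin (pairFun r 2 2 r)) (hs : (s : ℕ) = 0) :
    coloringSign (q := pairFun r 2 2) (edgeWordColoring h hp) (edgeColoring h s) = -rootSign r := by
  refine (coloringSign_edge h hp (q := pairFun r 2 2) ?_ s).trans ?_
  · intro x
    dsimp only [pairFun]
    split_ifs <;> decide
  · rcases pair_cases h with ⟨rfl, rfl⟩ | ⟨rfl, rfl⟩ <;>
      obtain rfl : s = (0 : Fin 2) := Fin.ext hs <;> decide +revert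

theorem coloringSign_zero_three_right (h : r ≠ c) (hp : 0 = pairFun r 0 0 r + pairFun r 0 0 c)
    (s : Fin (pairFun r 2 2 r)) (hs : (s : ℕ) = 1) :
    coloringSign (q := pairFun r 2 2) (edgeWordColoring h hp) (edgeColoring h s) = rootSign r := by
  refine (coloringSign_edge h hp (q := pairFun r 2 2) ?_ s).trans ?_
  · intro x
    dsimp only [pairFun]
    split_ifs <;> decide
  · rcases pair_cases h with ⟨rfl, rfl⟩ | ⟨rfl, rfl⟩ <;>
      obtain rfl : s = (1 : Fin 2) := Fin.ext hs <;> decide +revert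

/-- The letters are a horizontal one of `r` and a vertical one of `c`. Vertical letters come first,
so the input `s` does not matter. -/
theorem coloringSign_one_two_binary (h : r ≠ c) (hp : 1 = pairFun r 0 1 r + pairFun r 0 1 c)
    (s : Fin (pairFun r 2 1 r)) :
    coloringSign (q := pairFun r 2 1) (edgeWordColoring h hp) (edgeColoring h s) = -rootSign r := by
  refine (coloringSign_edge h hp (q := pairFun r 2 1) ?_ s).trans ?_
  · intro x
    dsimp only [pairFun]
    split_ifs <;> decide
  · rcases pair_cases h with ⟨rfl, rfl⟩ | ⟨rfl, rfl⟩ <;> revert s <;>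
      refine Fin.forall_fin_two.2 ⟨?_, ?_⟩ <;> decide +revert

theorem coloringSign_one_two_unary (h : r ≠ c) (hp : 1 = pairFun r 1 0 r + pairFun r 1 0 c)
    (s : Fin (pairFun r 1 2 r)) :
    coloringSign (q := pairFun r 1 2) (edgeWordColoring h hp) (edgeColoring h s) = rootSign r := by
  refine (coloringSign_edge h hp (q := pairFun r 1 2) ?_ s).trans ?_
  · intro x
    dsimp only [pairFun]
    split_ifs <;> decide
  · rcases pair_cases h with ⟨rfl, rfl⟩ | ⟨rfl, rfl⟩ <;> revert s <;>
      refine Fin.forall_fin_one.2 ?_ <;> decide +revert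

theorem coloringSign_two_one (h : r ≠ c) (hp : 2 = pairFun r 1 1 r + pairFun r 1 1 c)
    (s : Fin (pairFun r 1 1 r)) :
    coloringSign (q := pairFun r 1 1) (edgeWordColoring h hp) (edgeColoring h s) = rootSign r := by
  refine (coloringSign_edge h hp (q := pairFun r 1 1) ?_ s).trans ?_
  · intro x
    dsimp only [pairFun]
    split_ifs <;> decide
  · rcases pair_cases h with ⟨rfl, rfl⟩ | ⟨rfl, rfl⟩ <;> revert s <;>
      refine Fin.forall_fin_one.2 ?_ <;> decide +revert

variable {k : Type t} [Field k] {C : Type u} [Category.{v} C] {A : C ⥤ NUAlg.{t, w} k}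

theorem composeCochains_zero_three_left (h : r ≠ c) (hp : 0 = pairFun r 0 0 r + pairFun r 0 0 c)
    (s : Fin (pairFun r 2 2 r)) (hs : (s : ℕ) = 0) (f : Fin 2 → TotCochain A) (φ : Simplex C 0)
    (a : Fin 3 → A.obj (φ.vertex (Fin.last 0))) :
    composeCochains (edgeZeta h hp) (edgeColoring h s)
      (fun x => f x (pairFun r 0 0 x) (pairFun r 2 2 x)) 3 φ a =
      binaryPart (f r) (φ.vertex 0) (binaryPart (f c) (φ.vertex 0) (a 0) (a 1)) (a 2) := by
  -- The index types reduce to numerals only for concrete `r` and `c`. A tuple `v` over `Fin 2`,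
  -- fixed beforehand, serves both cases.
  have key : ∀ v : Fin 2 → A.obj (φ.vertex 0), v 0 = binaryPart (f c) (φ.vertex 0) (a 0) (a 1) →
      v 1 = a 2 →
      composeCochains (edgeZeta h hp) (edgeColoring h s)
      (fun x => f x (pairFun r 0 0 x) (pairFun r 2 2 x)) 3 φ a =
      binaryPart (f r) (φ.vertex 0) (v 0) (v 1) := by
    intro v h0 h1
    have hcomp := composeCochains_edgeColoring (p := pairFun r 0 0) (q := pairFun r 2 2) h
      (edgeZeta h hp) s (fun x => f x (pairFun r 0 0 x) (pairFun r 2 2 x)) φ a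
    rcases pair_cases h with ⟨rfl, rfl⟩ | ⟨rfl, rfl⟩
    all_goals
      obtain rfl : s = (0 : Fin 2) := Fin.ext hs
      refine (hcomp v
        (![a 0, a 1] : Fin 2 → A.obj (φ.vertex 0)) ?_ ?_ ?_).trans ?_
      · symm
        refine Eq.trans ?_ h0.symm
        refine (trans_self φ 0 _).trans ?_
        exact binaryPart_vertex _ _ _
      · refine Fin.forall_fin_two.2 ⟨?_, ?_⟩
        · intro h
          exact absurd rfl h
        · intro _
          -- Both inputs of `c` precede the second input of `r`, so this one receives `a 2`.
          refine ⟨2, ?_, h1.trans (trans_self φ 0 _).symm⟩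
          rw [inputIndex_edgeColoring]
          decide
      · refine Fin.forall_fin_two.2 ⟨⟨0, ?_, (trans_self φ 0 _).symm⟩,
          ⟨1, ?_, (trans_self φ 0 _).symm⟩⟩ <;>
        · rw [inputIndex_edgeColoring]
          decide
      · refine (trans_self φ 0 _).trans ?_
        exact binaryPart_vertex _ _ _
  exact key ![_, _] rfl rfl

theorem composeCochains_zero_three_right (h : r ≠ c) (hp : 0 = pairFun r 0 0 r + pairFun r 0 0 c)
    (s : Fin (pairFun r 2 2 r)) (hs : (s : ℕ) = 1) (f : Fin 2 → TotCochain A) (φ : Simplex C 0)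
    (a : Fin 3 → A.obj (φ.vertex (Fin.last 0))) :
    composeCochains (edgeZeta h hp) (edgeColoring h s)
      (fun x => f x (pairFun r 0 0 x) (pairFun r 2 2 x)) 3 φ a =
      binaryPart (f r) (φ.vertex 0) (a 0) (binaryPart (f c) (φ.vertex 0) (a 1) (a 2)) := by
  have key : ∀ v : Fin 2 → A.obj (φ.vertex 0), v 0 = a 0 →
      v 1 = binaryPart (f c) (φ.vertex 0) (a 1) (a 2) →
      composeCochains (edgeZeta h hp) (edgeColoring h s)
      (fun x => f x (pairFun r 0 0 x) (pairFun r 2 2 x)) 3 φ a =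
      binaryPart (f r) (φ.vertex 0) (v 0) (v 1) := by
    intro v h0 h1
    have hcomp := composeCochains_edgeColoring (p := pairFun r 0 0) (q := pairFun r 2 2) h
      (edgeZeta h hp) s (fun x => f x (pairFun r 0 0 x) (pairFun r 2 2 x)) φ a
    rcases pair_cases h with ⟨rfl, rfl⟩ | ⟨rfl, rfl⟩
    all_goals
      obtain rfl : s = (1 : Fin 2) := Fin.ext hs
      refine (hcomp v
        (![a 1, a 2] : Fin 2 → A.obj (φ.vertex 0)) ?_ ?_ ?_).trans ?_
      · symm
        refine Eq.trans ?_ h1.symm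
        refine (trans_self φ 0 _).trans ?_
        exact binaryPart_vertex _ _ _
      · refine Fin.forall_fin_two.2 ⟨?_, ?_⟩
        · intro _
          refine ⟨0, ?_, h0.trans (trans_self φ 0 _).symm⟩
          rw [inputIndex_edgeColoring]
          decide
        · intro h
          exact absurd rfl h
      · refine Fin.forall_fin_two.2 ⟨⟨1, ?_, (trans_self φ 0 _).symm⟩,
          ⟨2, ?_, (trans_self φ 0 _).symm⟩⟩ <;>
        · rw [inputIndex_edgeColoring]
          decide
      · refine (trans_self φ 0 _).trans ?_
        exact binaryPart_vertex _ _ _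
  exact key ![_, _] rfl rfl

theorem composeCochains_one_two_left (h : r ≠ c) (hp : 1 = pairFun r 0 1 r + pairFun r 0 1 c)
    (s : Fin (pairFun r 2 1 r)) (hs : (s : ℕ) = 0) (f : Fin 2 → TotCochain A) (φ : Simplex C 1)
    (a : Fin 2 → A.obj (φ.vertex (Fin.last 1))) :
    composeCochains (edgeZeta h hp) (edgeColoring h s)
      (fun x => f x (pairFun r 0 1 x) (pairFun r 2 1 x)) 2 φ a =
      binaryPart (f r) (φ.vertex 0) (unaryPart (f c) (φ.arrow (by decide : (0 : Fin 2) ≤ 1)) (a 0))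
          (trans A φ 0 1 (a 1)) := by
  have key : ∀ v : Fin 2 → A.obj (φ.vertex 0),
      v 0 = unaryPart (f c) (φ.arrow (by decide : (0 : Fin 2) ≤ 1)) (a 0) →
      v 1 = trans A φ 0 1 (a 1) →
      composeCochains (edgeZeta h hp) (edgeColoring h s)
      (fun x => f x (pairFun r 0 1 x) (pairFun r 2 1 x)) 2 φ a =
      binaryPart (f r) (φ.vertex 0) (v 0) (v 1) := by
    intro v h0 h1
    have hcomp := composeCochains_edgeColoring (p := pairFun r 0 1) (q := pairFun r 2 1) h
      (edgeZeta h hp) s (fun x => f x (pairFun r 0 1 x) (pairFun r 2 1 x)) φ a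
    rcases pair_cases h with ⟨rfl, rfl⟩ | ⟨rfl, rfl⟩
    all_goals
      obtain rfl : s = (0 : Fin 2) := Fin.ext hs
      refine (hcomp v
        (![a 0] : Fin 1 → A.obj (φ.vertex 1)) ?_ ?_ ?_).trans ?_
      · symm
        refine Eq.trans ?_ h0.symm
        refine (trans_self φ 0 _).trans ?_
        exact unaryPart_arrow _ _ _
      · refine Fin.forall_fin_two.2 ⟨?_, ?_⟩
        · intro h
          exact absurd rfl h
        · intro _
          refine ⟨1, ?_, h1⟩
          rw [inputIndex_edgeColoring]
          decide
      · refine Fin.forall_fin_one.2 ⟨0, ?_, (trans_self φ 1 _).symm⟩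
        rw [inputIndex_edgeColoring]
        decide
      · refine (trans_self φ 0 _).trans ?_
        exact binaryPart_vertex _ _ _
  exact key ![_, _] rfl rfl

theorem composeCochains_one_two_right (h : r ≠ c) (hp : 1 = pairFun r 0 1 r + pairFun r 0 1 c)
    (s : Fin (pairFun r 2 1 r)) (hs : (s : ℕ) = 1) (f : Fin 2 → TotCochain A) (φ : Simplex C 1)
    (a : Fin 2 → A.obj (φ.vertex (Fin.last 1))) :
    composeCochains (edgeZeta h hp) (edgeColoring h s)
      (fun x => f x (pairFun r 0 1 x) (pairFun r 2 1 x)) 2 φ a =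
      binaryPart (f r) (φ.vertex 0) (trans A φ 0 1 (a 0))
          (unaryPart (f c) (φ.arrow (by decide : (0 : Fin 2) ≤ 1)) (a 1)) := by
  have key : ∀ v : Fin 2 → A.obj (φ.vertex 0), v 0 = trans A φ 0 1 (a 0) →
      v 1 = unaryPart (f c) (φ.arrow (by decide : (0 : Fin 2) ≤ 1)) (a 1) →
      composeCochains (edgeZeta h hp) (edgeColoring h s)
      (fun x => f x (pairFun r 0 1 x) (pairFun r 2 1 x)) 2 φ a =
      binaryPart (f r) (φ.vertex 0) (v 0) (v 1) := by
    intro v h0 h1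
    have hcomp := composeCochains_edgeColoring (p := pairFun r 0 1) (q := pairFun r 2 1) h
      (edgeZeta h hp) s (fun x => f x (pairFun r 0 1 x) (pairFun r 2 1 x)) φ a
    rcases pair_cases h with ⟨rfl, rfl⟩ | ⟨rfl, rfl⟩
    all_goals
      obtain rfl : s = (1 : Fin 2) := Fin.ext hs
      refine (hcomp v
        (![a 1] : Fin 1 → A.obj (φ.vertex 1)) ?_ ?_ ?_).trans ?_
      · symm
        refine Eq.trans ?_ h1.symm
        refine (trans_self φ 0 _).trans ?_
        exact unaryPart_arrow _ _ _
      · refine Fin.forall_fin_two.2 ⟨?_, ?_⟩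
        · intro _
          refine ⟨0, ?_, h0⟩
          rw [inputIndex_edgeColoring]
          decide
        · intro h
          exact absurd rfl h
      · refine Fin.forall_fin_one.2 ⟨1, ?_, (trans_self φ 1 _).symm⟩
        rw [inputIndex_edgeColoring]
        decide
      · refine (trans_self φ 0 _).trans ?_
        exact binaryPart_vertex _ _ _
  exact key ![_, _] rfl rfl

theorem composeCochains_one_two_unary (h : r ≠ c) (hp : 1 = pairFun r 1 0 r + pairFun r 1 0 c)
    (s : Fin (pairFun r 1 2 r)) (f : Fin 2 → TotCochain A) (φ : Simplex C 1)
    (a : Fin 2 → A.obj (φ.vertex (Fin.last 1))) :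
    composeCochains (edgeZeta h hp) (edgeColoring h s)
      (fun x => f x (pairFun r 1 0 x) (pairFun r 1 2 x)) 2 φ a =
      unaryPart (f r) (φ.arrow (by decide : (0 : Fin 2) ≤ 1))
          (binaryPart (f c) (φ.vertex 1) (a 0) (a 1)) := by
  have key : ∀ v : Fin 1 → A.obj (φ.vertex 1), v 0 = binaryPart (f c) (φ.vertex 1) (a 0) (a 1) →
      composeCochains (edgeZeta h hp) (edgeColoring h s)
      (fun x => f x (pairFun r 1 0 x) (pairFun r 1 2 x)) 2 φ a =
      unaryPart (f r) (φ.arrow (by decide : (0 : Fin 2) ≤ 1)) (v 0) := by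
    intro v h0
    have hcomp := composeCochains_edgeColoring (p := pairFun r 1 0) (q := pairFun r 1 2) h
      (edgeZeta h hp) s (fun x => f x (pairFun r 1 0 x) (pairFun r 1 2 x)) φ a
    rcases pair_cases h with ⟨rfl, rfl⟩ | ⟨rfl, rfl⟩
    all_goals
      obtain rfl : s = (0 : Fin 1) := Subsingleton.elim (α := Fin 1) _ _
      refine (hcomp v
        (![a 0, a 1] : Fin 2 → A.obj (φ.vertex 1)) ?_ ?_ ?_).trans ?_
      · symm
        refine Eq.trans ?_ h0.symm
        refine (trans_self φ 1 _).trans ?_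
        exact binaryPart_vertex _ _ _
      · exact fun i hi => absurd (Subsingleton.elim (α := Fin 1) _ _) hi
      · refine Fin.forall_fin_two.2 ⟨⟨0, ?_, (trans_self φ 1 _).symm⟩,
          ⟨1, ?_, (trans_self φ 1 _).symm⟩⟩ <;>
        · rw [inputIndex_edgeColoring]
          decide
      · refine (trans_self φ 0 _).trans ?_
        exact unaryPart_arrow _ _ _
  exact key ![_] rfl

theorem composeCochains_two_one (h : r ≠ c) (hp : 2 = pairFun r 1 1 r + pairFun r 1 1 c)
    (s : Fin (pairFun r 1 1 r)) (f : Fin 2 → TotCochain A) (φ : Simplex C 2)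
    (a : Fin 1 → A.obj (φ.vertex (Fin.last 2))) :
    composeCochains (edgeZeta h hp) (edgeColoring h s)
      (fun x => f x (pairFun r 1 1 x) (pairFun r 1 1 x)) 1 φ a =
      unaryPart (f r) (φ.arrow (by decide : (0 : Fin 3) ≤ 1))
          (unaryPart (f c) (φ.arrow (by decide : (1 : Fin 3) ≤ 2)) (a 0)) := by
  have key : ∀ v : Fin 1 → A.obj (φ.vertex 1),
      v 0 = unaryPart (f c) (φ.arrow (by decide : (1 : Fin 3) ≤ 2)) (a 0) →
      composeCochains (edgeZeta h hp) (edgeColoring h s)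
      (fun x => f x (pairFun r 1 1 x) (pairFun r 1 1 x)) 1 φ a =
      unaryPart (f r) (φ.arrow (by decide : (0 : Fin 3) ≤ 1)) (v 0) := by
    intro v h0
    have hcomp := composeCochains_edgeColoring (p := pairFun r 1 1) (q := pairFun r 1 1) h
      (edgeZeta h hp) s (fun x => f x (pairFun r 1 1 x) (pairFun r 1 1 x)) φ a
    rcases pair_cases h with ⟨rfl, rfl⟩ | ⟨rfl, rfl⟩
    all_goals
      obtain rfl : s = (0 : Fin 1) := Subsingleton.elim (α := Fin 1) _ _
      refine (hcomp v
        (![a 0] : Fin 1 → A.obj (φ.vertex 2)) ?_ ?_ ?_).trans ?_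
      · symm
        refine Eq.trans ?_ h0.symm
        refine (trans_self φ 1 _).trans ?_
        exact unaryPart_arrow _ _ _
      · exact fun i hi => absurd (Subsingleton.elim (α := Fin 1) _ _) hi
      · refine Fin.forall_fin_one.2 ⟨0, ?_, (trans_self φ 2 _).symm⟩
        rw [inputIndex_edgeColoring]
        decide
      · refine (trans_self φ 0 _).trans ?_
        exact unaryPart_arrow _ _ _
  exact key ![_] rfl

end EdgeQuilt

section EdgeQuilt

variable {k : Type t} [Field k] {C : Type u} [Category.{v} C] {A : C ⥤ NUAlg.{t, w} k}
variable {r c : Fin 2} {f : Fin 2 → TotCochain A}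

theorem act_edgeQuilt_zero_three (h : r ≠ c) (hf : ∀ a, IsDeformationCochain (f a))
    (φ : Simplex C 0) (a : Fin 3 → A.obj (φ.vertex (Fin.last 0))) :
    (edgeQuilt r c h).act f 0 3 φ a = rootSign r •
      (binaryPart (f r) (φ.vertex 0) (a 0) (binaryPart (f c) (φ.vertex 0) (a 1) (a 2)) -
        binaryPart (f r) (φ.vertex 0) (binaryPart (f c) (φ.vertex 0) (a 0) (a 1)) (a 2)) := by
  have hp : 0 = pairFun r 0 0 r + pairFun r 0 0 c := by simp
  have h0 : 0 < pairFun r 2 2 r := by rw [pairFun_self]; decide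
  have h1 : 1 < pairFun r 2 2 r := by rw [pairFun_self]; decide
  rw [(edgeQuilt r c h).act_apply hf 0 3 {(pairFun r 0 0, pairFun r 2 2)}, Finset.sum_singleton,
    sum_edgeQuilt h hp (fun x => f x (pairFun r 0 0 x) (pairFun r 2 2 x)),
    sum_fin_of_eq_two (pairFun_self r 2 2), coloringSign_zero_three_left h hp _ rfl,
    coloringSign_zero_three_right h hp _ rfl]
  · refine (congrArg₂ (fun X Y => -rootSign r • X + rootSign r • Y)
      (composeCochains_zero_three_left h hp ⟨0, h0⟩ rfl f φ a)
      (composeCochains_zero_three_right h hp ⟨1, h1⟩ rfl f φ a)).trans ?_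
    rw [neg_smul, smul_sub]
    abel
  · simp
  · intro p q hpq hq hp' hq' _ _
    rw [sum_pair_eq h] at hp' hq'
    have := hpq r
    have := hpq c
    rw [Finset.mem_singleton, Prod.mk.injEq]
    exact ⟨eq_pairFun h (by omega) (by omega), eq_pairFun h (by omega) (by omega)⟩

/-- Two distributions of bidegrees occur: a binary `r` with the unary `c` in either input, or a
unary `r` applied to a binary `c`. -/
theorem act_edgeQuilt_one_two (h : r ≠ c) (hf : ∀ a, IsDeformationCochain (f a))
    (φ : Simplex C 1) (a : Fin 2 → A.obj (φ.vertex (Fin.last 1))) :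
    (edgeQuilt r c h).act f 1 2 φ a = rootSign r •
      (unaryPart (f r) (φ.arrow (by decide : (0 : Fin 2) ≤ 1))
          (binaryPart (f c) (φ.vertex 1) (a 0) (a 1)) -
        binaryPart (f r) (φ.vertex 0)
          (unaryPart (f c) (φ.arrow (by decide : (0 : Fin 2) ≤ 1)) (a 0)) (trans A φ 0 1 (a 1)) -
        binaryPart (f r) (φ.vertex 0) (trans A φ 0 1 (a 0))
          (unaryPart (f c) (φ.arrow (by decide : (0 : Fin 2) ≤ 1)) (a 1))) := by
  have hp : 1 = pairFun r 0 1 r + pairFun r 0 1 c := by rw [pairFun_self, pairFun_of_ne h]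
  have hp2 : 1 = pairFun r 1 0 r + pairFun r 1 0 c := by rw [pairFun_self, pairFun_of_ne h]
  have hne : (pairFun r 0 1, pairFun r 2 1) ≠ (pairFun r 1 0, pairFun r 1 2) := by
    intro heq
    have := congrFun (congrArg Prod.fst heq) r
    simp only [pairFun_self] at this
    omega
  have h0 : 0 < pairFun r 2 1 r := by rw [pairFun_self]; decide
  have h1 : 1 < pairFun r 2 1 r := by rw [pairFun_self]; decide
  rw [(edgeQuilt r c h).act_apply hf 1 2
      {(pairFun r 0 1, pairFun r 2 1), (pairFun r 1 0, pairFun r 1 2)}, Finset.sum_pair hne,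
    sum_edgeQuilt h hp (fun x => f x (pairFun r 0 1 x) (pairFun r 2 1 x)),
    sum_edgeQuilt h hp2 (fun x => f x (pairFun r 1 0 x) (pairFun r 1 2 x)),
    sum_fin_of_eq_two (pairFun_self r 2 1), sum_fin_of_eq_one (pairFun_self r 1 2),
    coloringSign_one_two_binary, coloringSign_one_two_binary, coloringSign_one_two_unary]
  · refine (congrArg₂ (fun X Y => X + rootSign r • Y)
      (congrArg₂ (fun X Y => -rootSign r • X + -rootSign r • Y)
        (composeCochains_one_two_left h hp ⟨0, h0⟩ rfl f φ a)
        (composeCochains_one_two_right h hp ⟨1, h1⟩ rfl f φ a))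
      (composeCochains_one_two_unary h hp2 _ f φ a)).trans ?_
    rw [neg_smul, neg_smul, smul_sub, smul_sub]
    abel
  · intro s hs
    rw [sum_pair_eq h, sum_pair_eq h]
    rcases Finset.mem_insert.1 hs with rfl | hs
    · simp only [pairFun_self, pairFun_of_ne h]
      decide
    · obtain rfl := Finset.mem_singleton.1 hs
      simp only [pairFun_self, pairFun_of_ne h]
      decide
  · intro p q hpq hq hp' hq' _ _
    rw [sum_pair_eq h] at hp' hq'
    have := hpq r
    have := hpq c
    rw [Finset.mem_insert, Finset.mem_singleton, Prod.mk.injEq, Prod.mk.injEq]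
    by_cases h0 : p r = 0
    · exact Or.inl ⟨eq_pairFun h (by omega) (by omega), eq_pairFun h (by omega) (by omega)⟩
    · exact Or.inr ⟨eq_pairFun h (by omega) (by omega), eq_pairFun h (by omega) (by omega)⟩

theorem act_edgeQuilt_two_one (h : r ≠ c) (hf : ∀ a, IsDeformationCochain (f a))
    (φ : Simplex C 2) (a : Fin 1 → A.obj (φ.vertex (Fin.last 2))) :
    (edgeQuilt r c h).act f 2 1 φ a = rootSign r •
      unaryPart (f r) (φ.arrow (by decide : (0 : Fin 3) ≤ 1))
        (unaryPart (f c) (φ.arrow (by decide : (1 : Fin 3) ≤ 2)) (a 0)) := by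
  have hp : 2 = pairFun r 1 1 r + pairFun r 1 1 c := by simp
  rw [(edgeQuilt r c h).act_apply hf 2 1 {(pairFun r 1 1, pairFun r 1 1)}, Finset.sum_singleton,
    sum_edgeQuilt h hp (fun x => f x (pairFun r 1 1 x) (pairFun r 1 1 x)),
    sum_fin_of_eq_one (pairFun_self r 1 1), coloringSign_two_one]
  · exact congrArg (fun X => rootSign r • X) (composeCochains_two_one h hp _ f φ a)
  · simp
  · intro p q hpq hq hp' hq' _ _
    rw [sum_pair_eq h] at hp' hq'
    have := hpq r
    have := hpq c
    have := hq r
    have := hq c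
    rw [Finset.mem_singleton, Prod.mk.injEq]
    exact ⟨eq_pairFun h (by omega) (by omega), eq_pairFun h (by omega) (by omega)⟩

end EdgeQuilt

/-! ### The action of the quilt of arity three -/

section CherryQuilt

/-- The maps of the word coloring of the word `0 1 2 1` over `[1]`. -/
def cherryZeta (a : Fin 3) : Fin ((![0, 1, 1] : Fin 3 → ℕ) a + 1) ↪o Fin (1 + 1) :=
  OrderEmbedding.ofStrictMono
    (fun i => ⟨i, lt_of_lt_of_le i.2 (by revert a; decide)⟩)
    (fun _ _ hij => hij)

theorem cherryZeta_val (a : Fin 3) (i : Fin ((![0, 1, 1] : Fin 3 → ℕ) a + 1)) :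
    (cherryZeta a i : ℕ) = i := rfl

/-- The occurrences of the letters that belong to the word coloring of `0 1 2 1` over `[1]`. -/
def cherryPi (a : Fin 3) (i : Fin ((![0, 1, 1] : Fin 3 → ℕ) a + 1)) : Fin 4 :=
  if a = 0 then 0 else if a = 2 then 2 else if (i : ℕ) = 0 then 1 else 3

/-- The word coloring of the word `0 1 2 1` over `[1]`. -/
def cherryWordColoring : WordColoring cherryQuilt.word ![0, 1, 1] 1 where
  ζ := cherryZeta
  cover := by
    exact fun j => ⟨1, j, Fin.ext (cherryZeta_val 1 j)⟩
  exists_pi := by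
    refine ⟨cherryPi, ?_, ?_, ?_⟩
    · intro a
      ext i
      revert a i
      exact (by decide : ∀ (a : Fin 3) (i : Fin 4), (∃ s, cherryPi a s = i) ↔
        (![0, 1, 2, 1] : Fin 4 → Fin 3) i = a)
    · refine fun i => ⟨fun x hx y hy z hz => ?_⟩
      have : ∀ x y z : Fin (1 + 1), x ≤ z ∧ z ≤ y → z = x ∨ z = y := by decide
      rcases this x y z hz with rfl | rfl
      · exact hx
      · exact hy
    · have key : ∀ i j : Fin 4, (j : ℕ) = i + 1 → ∃ m : Fin 2,
          ((∃ s, cherryPi (cherryQuilt.word i) s = i ∧ cherryZeta (cherryQuilt.word i) s = m) ∧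
            ∀ s, cherryPi (cherryQuilt.word i) s = i → cherryZeta (cherryQuilt.word i) s ≤ m) ∧
          ((∃ s, cherryPi (cherryQuilt.word j) s = j ∧ cherryZeta (cherryQuilt.word j) s = m) ∧
            ∀ s, cherryPi (cherryQuilt.word j) s = j → m ≤ cherryZeta (cherryQuilt.word j) s) := by
        decide
      intro i j hij
      obtain ⟨m, ⟨h1, h2⟩, h3, h4⟩ := key i j hij
      refine ⟨m, ⟨h1, ?_⟩, h3, ?_⟩
      · rintro _ ⟨s, hs, rfl⟩
        exact h2 s hs
      · rintro _ ⟨s, hs, rfl⟩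
        exact h4 s hs

/-- A strictly increasing self-map of `[1]` is the identity, which settles the letters `1` and `2`.
The letter `0` precedes `1`, so its only value is at most `ζ 1 0 = 0`. -/
theorem eq_cherryWordColoring (Z : WordColoring cherryQuilt.word ![0, 1, 1] 1) :
    Z = cherryWordColoring := by
  obtain ⟨π, hπ⟩ := Z.exists_pi
  have hid : ∀ (ζ : Fin (1 + 1) ↪o Fin (1 + 1)) (i : Fin (1 + 1)), (ζ i : ℕ) = i := by
    intro ζ i
    have h1 := orderEmb_add_le ζ i 0 i (by simp)
    have h2 := orderEmb_add_le ζ (1 - i) i 1 (by simp; omega)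
    omega
  have h1 : ∀ i, (Z.ζ 1 i : ℕ) = i := hid (Z.ζ 1)
  have h2 : ∀ i, (Z.ζ 2 i : ℕ) = i := hid (Z.ζ 2)
  have h0 : Z.ζ 0 0 ≤ Z.ζ 1 0 := by
    refine hπ.zeta_le_of_pi_lt ?_
    have : ∀ i j : Fin 4, cherryQuilt.word i = 0 → cherryQuilt.word j = 1 → i < j := by decide
    exact this _ _ (hπ.word_pi 0 0) (hπ.word_pi 1 0)
  have h0 := Fin.le_def.1 h0
  rw [h1] at h0
  refine WordColoring.ext ?_
  funext a
  ext i
  refine Eq.trans ?_ (cherryZeta_val a i).symm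
  revert a
  refine Fin.forall_fin_succ.2 ⟨fun i => ?_, Fin.forall_fin_two.2 ⟨h1, h2⟩⟩
  have hi : i = 0 := Subsingleton.elim (α := Fin 1) _ _
  rw [hi]
  exact Nat.le_zero.1 h0

/-- The coloring of the tree with the root `0` and its children `2` and `1`, if the root has two
inputs. -/
def cherryColoring : TreeColoring cherryTree ![2, 1, 1] where
  slot e := Fin.cast (by rw [e.2.1]; rfl) (if e.1.2 = 2 then (0 : Fin 2) else 1)
  slot_lt := by
    rintro x y z ⟨rfl, -⟩ - ⟨rfl, rfl⟩
    exact (by decide : (0 : Fin 2) < 1)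

theorem cherryColoring_slot (e : cherryTree.Edge) :
    (cherryColoring.slot e : ℕ) = if e.1.2 = 2 then 0 else 1 := by
  simp only [cherryColoring, Fin.val_cast]
  split_ifs <;> rfl

theorem cherryTree_edge_two : cherryTree.edge 0 2 := ⟨rfl, by decide⟩

theorem cherryTree_edge_one : cherryTree.edge 0 1 := ⟨rfl, by decide⟩

theorem cherryTree_slot_lt {q : Fin 3 → ℕ} (I : TreeColoring cherryTree q) :
    (I.slot ⟨(0, 2), cherryTree_edge_two⟩ : ℕ) < I.slot ⟨(0, 1), cherryTree_edge_one⟩ :=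
  I.slot_lt 0 2 1 _ _ ⟨rfl, rfl⟩

theorem eq_cherryColoring (I : TreeColoring cherryTree ![2, 1, 1]) : I = cherryColoring := by
  have h := cherryTree_slot_lt I
  have h1 : (I.slot ⟨(0, 1), cherryTree_edge_one⟩ : ℕ) < 2 :=
    (I.slot ⟨(0, 1), cherryTree_edge_one⟩).2
  refine TreeColoring.ext ?_
  funext ⟨⟨x, y⟩, hx, hy⟩
  simp only at hx hy
  subst hx
  refine Fin.ext (Eq.trans ?_ (cherryColoring_slot ⟨(0, y), rfl, hy⟩).symm)
  rcases (by omega : y = 1 ∨ y = 2) with rfl | rfl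
  · refine Eq.trans ?_ (if_neg (show (1 : Fin 3) ≠ 2 by decide)).symm
    change (I.slot ⟨(0, 1), cherryTree_edge_one⟩ : ℕ) = 1
    omega
  · refine Eq.trans ?_ (if_pos rfl).symm
    change (I.slot ⟨(0, 2), cherryTree_edge_two⟩ : ℕ) = 0
    omega

/-- The order of the inputs of the colored tree `cherryColoring`. -/
abbrev CherryInputBefore (x : Fin 3) (i : ℕ) (y : Fin 3) (j : ℕ) : Prop :=
  (x = y ∧ i < j) ∨ (x = 2 ∧ y = 1) ∨ (x = 0 ∧ y = 1 ∧ i < 1) ∨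
    (y = 0 ∧ (x = 2 ∨ (x = 1 ∧ 1 ≤ j)))

theorem inputBefore_cherryColoring (x : Fin 3) (i : ℕ) (y : Fin 3) (j : ℕ) :
    InputBefore cherryTree (fun e => (cherryColoring.slot e : ℕ)) x i y j ↔
      CherryInputBefore x i y j := by
  have hle : ∀ {c z}, c ≠ 0 → (cherryTree.le c z ↔ c = z) := by
    intro c z hc
    refine starEdge_reflTransGen.trans ?_
    simp [hc]
  constructor
  · rintro (h1 | h1 | ⟨d, ⟨hx, hd⟩, hy, hi⟩ | ⟨d, ⟨hx, hd⟩, hy, hi⟩)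
    · exact Or.inl h1
    · exact Or.inr (Or.inl h1)
    · replace hi := lt_of_lt_of_eq hi (cherryColoring_slot ⟨(x, d), hx, hd⟩)
      obtain rfl := (hle hd).1 hy
      simp only at hi hd
      split_ifs at hi with h2
      · omega
      · exact Or.inr (Or.inr (Or.inl ⟨hx, by omega, hi⟩))
    · replace hi := le_of_eq_of_le (cherryColoring_slot ⟨(y, d), hx, hd⟩).symm hi
      obtain rfl := (hle hd).1 hy
      simp only at hi hd
      split_ifs at hi with h2
      · exact Or.inr (Or.inr (Or.inr ⟨hx, Or.inl h2⟩))
      · exact Or.inr (Or.inr (Or.inr ⟨hx, Or.inr ⟨by omega, hi⟩⟩))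
  · rintro (h1 | h1 | ⟨rfl, rfl, hi⟩ | ⟨rfl, rfl | ⟨rfl, hi⟩⟩)
    · exact Or.inl h1
    · exact Or.inr (Or.inl h1)
    · exact Or.inr (Or.inr (Or.inl ⟨1, cherryTree_edge_one, (hle (by decide)).2 rfl,
        lt_of_lt_of_eq hi (cherryColoring_slot ⟨(0, 1), cherryTree_edge_one⟩).symm⟩))
    · exact Or.inr (Or.inr (Or.inr ⟨2, cherryTree_edge_two, (hle (by decide)).2 rfl,
        le_of_eq_of_le (cherryColoring_slot ⟨(0, 2), cherryTree_edge_two⟩) (Nat.zero_le _)⟩))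
    · exact Or.inr (Or.inr (Or.inr ⟨1, cherryTree_edge_one, (hle (by decide)).2 rfl,
        le_of_eq_of_le (cherryColoring_slot ⟨(0, 1), cherryTree_edge_one⟩) hi⟩))

theorem isFree_cherryColoring (x : Fin 3) (i : Fin ((![2, 1, 1] : Fin 3 → ℕ) x)) :
    cherryColoring.IsFree x i ↔ x ≠ 0 := by
  refine not_congr ⟨?_, ?_⟩
  · rintro ⟨d, ⟨hx, hd⟩, hi⟩
    exact hx
  · rintro rfl
    revert i
    refine Fin.forall_fin_two.2 ⟨⟨2, cherryTree_edge_two, Fin.ext ?_⟩,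
        ⟨1, cherryTree_edge_one, Fin.ext ?_⟩⟩
    · exact cherryColoring_slot ⟨(0, 2), cherryTree_edge_two⟩
    · exact cherryColoring_slot ⟨(0, 1), cherryTree_edge_one⟩

theorem inputIndex_cherryColoring (x : Fin 3) (i : Fin ((![2, 1, 1] : Fin 3 → ℕ) x)) :
    cherryColoring.inputIndex x i =
      (Finset.univ.filter (fun t : Σ y, Fin ((![2, 1, 1] : Fin 3 → ℕ) y) =>
        t.1 ≠ 0 ∧ CherryInputBefore t.1 t.2 x i)).card := by
  rw [TreeColoring.inputIndex]
  congr 1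
  ext t
  simp only [Finset.mem_filter, isFree_cherryColoring, inputBefore_cherryColoring]

/-- The initial word is: horizontal letter of `0`, vertical letter of `1`, vertical letter of `2`.
The vertex `2` is interposed, so its letter moves to the front, and the horizontal letter goes last.
The word is reversed: three inversions. -/
theorem coloringSign_cherry : coloringSign cherryWordColoring cherryColoring = -1 := by
  refine (coloringSign_eq cherryWordColoring cherryColoring (by decide) (by decide)
    inputBefore_cherryColoring).trans ?_
  decide

theorem cherryTree_root : cherryTree.root = 0 :=
  PlanarTree.root_eq fun x hx => by
    rcases starEdge_reflTransGen.1 hx with h | h <;> exact h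

variable {k : Type t} [Field k] {C : Type u} [Category.{v} C] {A : C ⥤ NUAlg.{t, w} k}
variable {f : Fin 3 → TotCochain A}

theorem composeCochains_cherry (f : Fin 3 → TotCochain A) (φ : Simplex C 1)
    (a : Fin 2 → A.obj (φ.vertex (Fin.last 1))) :
    composeCochains cherryZeta cherryColoring
      (fun x => f x ((![0, 1, 1] : Fin 3 → ℕ) x) ((![2, 1, 1] : Fin 3 → ℕ) x)) 2 φ a =
    binaryPart (f 0) (φ.vertex 0)
      (unaryPart (f 2) (φ.arrow (by decide : (0 : Fin 2) ≤ 1)) (a 0))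
      (unaryPart (f 1) (φ.arrow (by decide : (0 : Fin 2) ≤ 1)) (a 1)) := by
  have hcomp := composeCochains_eq cherryZeta cherryColoring
    (fun x => f x ((![0, 1, 1] : Fin 3 → ℕ) x) ((![2, 1, 1] : Fin 3 → ℕ) x)) φ a cherryTree_root
  have hsucc := evalAt_succ cherryZeta cherryColoring
    (fun x => f x ((![0, 1, 1] : Fin 3 → ℕ) x) ((![2, 1, 1] : Fin 3 → ℕ) x)) φ a
  have h2 := hsucc 1 2 (![a 0] : Fin 1 → A.obj (φ.vertex 1)) (fun c e => by cases e.1)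
    (Fin.forall_fin_one.2 fun _ => ⟨0, (inputIndex_cherryColoring 2 (0 : Fin 1)).trans (by decide),
      (trans_self φ 1 _).symm⟩)
  have h1 := hsucc 1 1 (![a 1] : Fin 1 → A.obj (φ.vertex 1)) (fun c e => by cases e.1)
    (Fin.forall_fin_one.2 fun _ => ⟨1, (inputIndex_cherryColoring 1 (0 : Fin 1)).trans (by decide),
      (trans_self φ 1 _).symm⟩)
  have key : ∀ v : Fin 2 → A.obj (φ.vertex 0),
      v 0 = unaryPart (f 2) (φ.arrow (by decide : (0 : Fin 2) ≤ 1)) (a 0) →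
      v 1 = unaryPart (f 1) (φ.arrow (by decide : (0 : Fin 2) ≤ 1)) (a 1) →
      composeCochains cherryZeta cherryColoring
        (fun x => f x ((![0, 1, 1] : Fin 3 → ℕ) x) ((![2, 1, 1] : Fin 3 → ℕ) x)) 2 φ a =
      binaryPart (f 0) (φ.vertex 0) (v 0) (v 1) := by
    intro v hv0 hv1
    refine hcomp.trans ((trans_self φ 0 _).trans ?_)
    refine (hsucc 2 0 v ?_ ?_).trans (binaryPart_vertex _ _ _)
    · rintro c ⟨-, hc⟩
      rcases (by omega : c = 1 ∨ c = 2) with rfl | rfl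
      · symm
        refine Eq.trans ?_ hv1.symm
        refine (trans_self φ 0 _).trans (h1.trans ?_)
        exact unaryPart_arrow _ _ _
      · symm
        refine Eq.trans ?_ hv0.symm
        refine (trans_self φ 0 _).trans (h2.trans ?_)
        exact unaryPart_arrow _ _ _
    · intro i hi
      exact absurd rfl ((isFree_cherryColoring 0 i).1 hi)
  exact key ![_, _] rfl rfl

theorem act_cherryQuilt_one_two (hf : ∀ a, IsDeformationCochain (f a))
    (φ : Simplex C 1) (a : Fin 2 → A.obj (φ.vertex (Fin.last 1))) :
    cherryQuilt.act f 1 2 φ a = -binaryPart (f 0) (φ.vertex 0)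
      (unaryPart (f 2) (φ.arrow (by decide : (0 : Fin 2) ≤ 1)) (a 0))
      (unaryPart (f 1) (φ.arrow (by decide : (0 : Fin 2) ≤ 1)) (a 1)) := by
  have hZ : Subsingleton (WordColoring cherryQuilt.word ![0, 1, 1] 1) :=
    ⟨fun Y Z => (eq_cherryWordColoring Y).trans (eq_cherryWordColoring Z).symm⟩
  have hI : Subsingleton (TreeColoring cherryQuilt.tree ![2, 1, 1]) :=
    ⟨fun Y Z => (eq_cherryColoring Y).trans (eq_cherryColoring Z).symm⟩
  rw [cherryQuilt.act_apply hf 1 2 {(![0, 1, 1], ![2, 1, 1])}, Finset.sum_singleton,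
    Fintype.sum_subsingleton _ cherryWordColoring]
  · rw [Fintype.sum_subsingleton (ι := TreeColoring cherryQuilt.tree ![2, 1, 1]) _ cherryColoring]
    refine (congrArg₂ (fun (s : ℤ) X => s • X) coloringSign_cherry
      (composeCochains_cherry f φ a)).trans ?_
    exact neg_one_smul ℤ _
  · intro s hs
    obtain rfl := Finset.mem_singleton.1 hs
    decide
  · intro p q hpq hq hp' hq' _ I
    -- All edges start at `0`, so the branching vertex is the root and `q 0 = 2`. Then `p 0 = 0`,
    -- and `∑ p = 2` forces `p 1 = p 2 = 1`.
    obtain ⟨_, -, -, ⟨rfl, -⟩, -, -, -, -, hz⟩ := I.exists_branch (x := 2) (y := 1) ⟨rfl, rfl⟩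
    rw [Fin.sum_univ_three] at hp'
    have e0 := hpq 0
    have e1 := hpq 1
    have e2 := hpq 2
    have q1 := hq 1
    have q2 := hq 2
    rw [Finset.mem_singleton, Prod.mk.injEq]
    constructor <;> funext x <;> revert x <;>
      refine Fin.forall_fin_succ.2 ⟨?_, Fin.forall_fin_two.2 ⟨?_, ?_⟩⟩ <;> simp <;> omega

theorem act_cherryQuilt_eq_zero (hf : ∀ a, IsDeformationCochain (f a)) {p' : ℕ} (q' : ℕ)
    (hp' : p' ≠ 1) : cherryQuilt.act f p' q' = 0 :=
  cherryQuilt.act_eq_zero hf p' q' fun _ _ hpq hq hp _ Z I =>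
    hp' (cherryQuilt.exists_branching rfl le_rfl hpq hq hp Z I).1

end CherryQuilt

theorem rootSign_zero : rootSign 0 = 1 := rfl

theorem rootSign_one : rootSign 1 = -1 := rfl

/-! ### The components of the Maurer-Cartan equation -/

section Deformation

variable {k : Type t} [Field k] {C : Type u} [Category.{v} C] {A : C ⥤ NUAlg.{t, w} k}

theorem binaryPart_add_left (f : TotCochain A) (x : C) (a a' b : A.obj x) :
    binaryPart f x (a + a') b = binaryPart f x a b + binaryPart f x a' b :=
  (f 0 2 (Simplex.ofObj x)).cons_add ![b] a a'

theorem binaryPart_smul_left (f : TotCochain A) (x : C) (c : k) (a b : A.obj x) :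
    binaryPart f x (c • a) b = c • binaryPart f x a b :=
  (f 0 2 (Simplex.ofObj x)).cons_smul ![b] c a

theorem update_pair_one {M : Type*} (a b c : M) : Function.update ![a, b] 1 c = ![a, c] := by
  funext i
  revert i
  exact Fin.forall_fin_two.2 ⟨rfl, rfl⟩

theorem binaryPart_add_right (f : TotCochain A) (x : C) (a b b' : A.obj x) :
    binaryPart f x a (b + b') = binaryPart f x a b + binaryPart f x a b' := by
  have h : ∀ c, f 0 2 (Simplex.ofObj x) (Function.update ![a, b] 1 c) = binaryPart f x a c :=
    fun c => congrArg (f 0 2 (Simplex.ofObj x)) (update_pair_one a b c)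
  exact (h _).symm.trans (((f 0 2 (Simplex.ofObj x)).map_update_add ![a, b] 1 b b').trans
    (congrArg₂ (· + ·) (h _) (h _)))

theorem binaryPart_smul_right (f : TotCochain A) (x : C) (c : k) (a b : A.obj x) :
    binaryPart f x a (c • b) = c • binaryPart f x a b := by
  have h : ∀ c, f 0 2 (Simplex.ofObj x) (Function.update ![a, b] 1 c) = binaryPart f x a c :=
    fun c => congrArg (f 0 2 (Simplex.ofObj x)) (update_pair_one a b c)
  exact (h _).symm.trans (((f 0 2 (Simplex.ofObj x)).map_update_smul ![a, b] 1 c b).trans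
    (congrArg (c • ·) (h _)))

theorem unaryPart_add (f : TotCochain A) {x y : C} (φ : x ⟶ y) (a a' : A.obj x) :
    unaryPart f φ (a + a') = unaryPart f φ a + unaryPart f φ a' :=
  (f 1 1 (Simplex.ofHom φ)).cons_add ![] a a'

theorem unaryPart_smul (f : TotCochain A) {x y : C} (φ : x ⟶ y) (c : k) (a : A.obj x) :
    unaryPart f φ (c • a) = c • unaryPart f φ a :=
  (f 1 1 (Simplex.ofHom φ)).cons_smul ![] c a

/-- The multiplication that is deformed by the component of `f` in `C^{0,2}`. -/
def deformedMul (f : TotCochain A) (x : C) : A.obj x →ₗ[k] A.obj x →ₗ[k] A.obj x :=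
  LinearMap.mk₂ k (fun a b => a * b + binaryPart f x a b)
    (fun a a' b => by rw [binaryPart_add_left, add_mul]; abel)
    (fun c a b => by rw [binaryPart_smul_left, smul_mul_assoc, smul_add])
    (fun a b b' => by rw [binaryPart_add_right, mul_add]; abel)
    (fun c a b => by rw [binaryPart_smul_right, mul_smul_comm, smul_add])

theorem deformedMul_apply (f : TotCochain A) (x : C) (a b : A.obj x) :
    deformedMul f x a b = a * b + binaryPart f x a b := rfl

/-- The map that is deformed by the component of `f` in `C^{1,1}`. -/
def deformedMap (f : TotCochain A) {x y : C} (φ : x ⟶ y) : A.obj x →ₗ[k] A.obj y where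
  toFun a := algMap A φ a + unaryPart f φ a
  map_add' a b := by rw [map_add, unaryPart_add]; abel
  map_smul' c a := by rw [map_smul, unaryPart_smul, RingHom.id_apply, smul_add]

theorem deformedMap_apply (f : TotCochain A) {x y : C} (φ : x ⟶ y) (a : A.obj x) :
    deformedMap f φ a = algMap A φ a + unaryPart f φ a := rfl

theorem binaryPart_zero_left (f : TotCochain A) (x : C) (b : A.obj x) :
    binaryPart f x 0 b = 0 := by
  have := binaryPart_smul_left f x 0 0 b
  rwa [zero_smul, zero_smul] at this

theorem binaryPart_zero_right (f : TotCochain A) (x : C) (a : A.obj x) :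
    binaryPart f x a 0 = 0 := by
  have := binaryPart_smul_right f x 0 a 0
  rwa [zero_smul, zero_smul] at this

variable {f : TotCochain A}

theorem isDeformationCochain_pair (hf : IsDeformationCochain f) :
    ∀ a : Fin 2, IsDeformationCochain ((![mulCochain A, f] : Fin 2 → TotCochain A) a) :=
  Fin.forall_fin_two.2 ⟨isDeformationCochain_mulCochain, hf⟩

/-- The left hand side of the Maurer-Cartan equation of a cochain of shifted degree one. -/
noncomputable def curvature (f : TotCochain A) : TotValues A :=
  deltaS f + deltaH f + (opP 2 (fun _ => f) + opP 3 (fun _ => f))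

theorem curvature_apply (hf : IsDeformationCochain f) (p' q' : ℕ) (φ : Simplex C p')
    (a : Fin q' → A.obj (φ.vertex (Fin.last p'))) : curvature f p' q' φ a =
      deltaS f p' q' φ a +
      ((edgeQuilt 0 1 (by decide)).act ![mulCochain A, f] p' q' φ a -
        (edgeQuilt 1 0 (by decide)).act ![mulCochain A, f] p' q' φ a) +
      ((edgeQuilt 0 1 (by decide)).act (fun _ => f) p' q' φ a +
        cherryQuilt.act (Fin.cons (mulCochain A) (fun _ => f)) p' q' φ a +
        cherryQuilt.act (fun _ => f) p' q' φ a) := by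
  rw [curvature, opP_two hf, opP_three hf]
  rfl

theorem deltaS_eq_zero (hf : IsDeformationCochain f) {p' q' : ℕ} (h : p' + q' ≠ 3 ∨ q' = 0) :
    deltaS f p' q' = 0 := by
  rcases p' with _ | p'
  · rfl
  · funext φ a
    have hz : f p' q' = 0 := hf _ _ (by omega)
    refine Finset.sum_eq_zero fun i _ => ?_
    rw [hz]
    exact (congrArg _ (map_zero _)).trans (smul_zero _)

theorem curvature_eq_zero (hf : IsDeformationCochain f) {p' q' : ℕ} (h : p' + q' ≠ 3 ∨ q' = 0) :
    curvature f p' q' = 0 := by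
  funext φ a
  rw [curvature_apply hf, deltaS_eq_zero hf h,
    Quilt.act_eq_zero_of_add_ne _ rfl (isDeformationCochain_pair hf) h,
    Quilt.act_eq_zero_of_add_ne _ rfl (isDeformationCochain_pair hf) h,
    Quilt.act_eq_zero_of_add_ne _ rfl (fun _ => hf) h,
    Quilt.act_eq_zero_of_add_ne _ rfl (isDeformationCochain_cons hf) h,
    Quilt.act_eq_zero_of_add_ne _ rfl (fun _ => hf) h]
  simp

/-- The associator of `m + f` is expanded: the mixed terms form the Hochschild coboundary, the terms
quadratic in `f` come from the one-edge quilt, and those without `f` cancel by associativity of `m`.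
-/
theorem curvature_zero_three (hf : IsDeformationCochain f) (φ : Simplex C 0)
    (a : Fin 3 → A.obj (φ.vertex 0)) :
    curvature f 0 3 φ a
        = deformedMul f (φ.vertex 0) (a 0) (deformedMul f (φ.vertex 0) (a 1) (a 2)) -
      deformedMul f (φ.vertex 0) (deformedMul f (φ.vertex 0) (a 0) (a 1)) (a 2) := by
  have h1 := act_edgeQuilt_zero_three (r := 0) (c := 1) (by decide)
    (isDeformationCochain_pair hf) φ a
  have h2 := act_edgeQuilt_zero_three (r := 1) (c := 0) (by decide)
    (isDeformationCochain_pair hf) φ a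
  have h3 := act_edgeQuilt_zero_three (r := 0) (c := 1) (by decide) (f := fun _ => f)
    (fun _ => hf) φ a
  rw [curvature_apply hf 0 3 φ a, h1, h2, h3,
    act_cherryQuilt_eq_zero (isDeformationCochain_cons hf) 3 (by decide),
    act_cherryQuilt_eq_zero (fun _ => hf) 3 (by decide)]
  have h0 : deltaS f 0 3 φ a = 0 := rfl
  rw [h0]
  generalize a 0 = x, a 1 = y, a 2 = z
  have hm : ∀ x y, binaryPart (![mulCochain A, f] 0) (φ.vertex 0) x y = x * y := fun _ _ => rfl
  have hb : ∀ x y, binaryPart (![mulCochain A, f] 1) (φ.vertex 0) x y =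
    binaryPart f (φ.vertex 0) x y := fun _ _ => rfl
  simp only [hm, hb, deformedMul_apply, mul_add, add_mul, binaryPart_add_left,
    binaryPart_add_right, mul_assoc, Pi.zero_apply, rootSign_zero, rootSign_one, one_smul,
    neg_smul]
  abel

theorem deltaS_one_two (f : TotCochain A) (φ : Simplex C 1) (a : Fin 2 → A.obj (φ.vertex 1)) :
    deltaS f 1 2 φ a =
      algMap A (φ.arrow (by decide : (0 : Fin 2) ≤ 1)) (binaryPart f (φ.vertex 1) (a 0) (a 1)) -
      binaryPart f (φ.vertex 0) (algMap A (φ.arrow (by decide : (0 : Fin 2) ≤ 1)) (a 0))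
        (algMap A (φ.arrow (by decide : (0 : Fin 2) ≤ 1)) (a 1)) := by
  refine (Fin.sum_univ_two _).trans ?_
  rw [sub_eq_add_neg]
  refine congrArg₂ (· + ·) ?_ ?_
  · refine (one_smul ℤ _).trans ?_
    refine (trans_of_le φ (by decide : (0 : Fin 2) ≤ 1) _).trans (congrArg _ ?_)
    refine (binaryPart_vertex f (φ.pull (Fin.succAboveOrderEmb 0)) _).trans ?_
    exact congrArg₂ (binaryPart f (φ.vertex 1)) (trans_self φ 1 _) (trans_self φ 1 _)
  · refine (neg_one_smul ℤ _).trans (congrArg _ ?_)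
    refine (trans_self φ 0 _).trans ?_
    refine (binaryPart_vertex f (φ.pull (Fin.succAboveOrderEmb 1)) _).trans ?_
    exact congrArg₂ (binaryPart f (φ.vertex 0)) (trans_of_le φ _ _) (trans_of_le φ _ _)

theorem deltaS_two_one (f : TotCochain A) (φ : Simplex C 2) (a : Fin 1 → A.obj (φ.vertex 2)) :
    deltaS f 2 1 φ a =
      algMap A (φ.arrow (by decide : (0 : Fin 3) ≤ 1))
        (unaryPart f (φ.arrow (by decide : (1 : Fin 3) ≤ 2)) (a 0)) -
      unaryPart f (φ.arrow (by decide : (0 : Fin 3) ≤ 2)) (a 0) +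
      unaryPart f (φ.arrow (by decide : (0 : Fin 3) ≤ 1))
        (algMap A (φ.arrow (by decide : (1 : Fin 3) ≤ 2)) (a 0)) := by
  refine (Fin.sum_univ_three _).trans ?_
  rw [sub_eq_add_neg]
  refine congrArg₂ (· + ·) (congrArg₂ (· + ·) ?_ ?_) ?_
  · refine (one_smul ℤ _).trans ?_
    refine (trans_of_le φ (by decide : (0 : Fin 3) ≤ 1) _).trans (congrArg _ ?_)
    refine (unaryPart_arrow f (φ.pull (Fin.succAboveOrderEmb 0)) _).trans ?_
    exact congrArg (unaryPart f (φ.arrow (by decide : (1 : Fin 3) ≤ 2))) (trans_self φ 2 _)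
  · refine (neg_one_smul ℤ _).trans (congrArg _ ?_)
    refine (trans_self φ 0 _).trans ?_
    refine (unaryPart_arrow f (φ.pull (Fin.succAboveOrderEmb 1)) _).trans ?_
    exact congrArg (unaryPart f (φ.arrow (by decide : (0 : Fin 3) ≤ 2))) (trans_self φ 2 _)
  · refine (congrArg (fun z : ℤ => z • _) (by decide : (-1 : ℤ) ^ ((2 : Fin 3) : ℕ) = 1)).trans ?_
    refine (one_smul ℤ _).trans ?_
    refine (trans_self φ 0 _).trans ?_
    refine (unaryPart_arrow f (φ.pull (Fin.succAboveOrderEmb 2)) _).trans ?_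
    exact congrArg (unaryPart f (φ.arrow (by decide : (0 : Fin 3) ≤ 1))) (trans_of_le φ _ _)

/-- The simplicial coboundary gives `A f(a,b) - f(A a, A b)`, the Hochschild coboundary the terms
with `m` linear in `g`, the one-edge quilt the terms with `f` linear in `g`, and the two cherries
`-(g a)(g b)` and `-f(g a, g b)`. The terms without `f` and `g` cancel because `A[φ]` is a
homomorphism. -/
theorem curvature_one_two (hf : IsDeformationCochain f) (φ : Simplex C 1)
    (a : Fin 2 → A.obj (φ.vertex 1)) :
    curvature f 1 2 φ a =
      deformedMap f (φ.arrow (by decide : (0 : Fin 2) ≤ 1))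
        (deformedMul f (φ.vertex 1) (a 0) (a 1)) -
      deformedMul f (φ.vertex 0) (deformedMap f (φ.arrow (by decide : (0 : Fin 2) ≤ 1)) (a 0))
        (deformedMap f (φ.arrow (by decide : (0 : Fin 2) ≤ 1)) (a 1)) := by
  have h1 := act_edgeQuilt_one_two (r := 0) (c := 1) (by decide)
    (isDeformationCochain_pair hf) φ a
  have h2 := act_edgeQuilt_one_two (r := 1) (c := 0) (by decide)
    (isDeformationCochain_pair hf) φ a
  have h3 := act_edgeQuilt_one_two (r := 0) (c := 1) (by decide) (f := fun _ => f)
    (fun _ => hf) φ a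
  have h4 := act_cherryQuilt_one_two (isDeformationCochain_cons hf) φ a
  have h5 := act_cherryQuilt_one_two (f := fun _ => f) (fun _ => hf) φ a
  rw [curvature_apply hf 1 2 φ a, deltaS_one_two, h1, h2, h3, h4, h5]
  rw [trans_of_le φ (by decide : (0 : Fin 2) ≤ 1), trans_of_le φ (by decide : (0 : Fin 2) ≤ 1)]
  generalize a 0 = x, a 1 = y
  generalize φ.arrow (by decide : (0 : Fin 2) ≤ 1) = ψ
  have hm : ∀ z x y, binaryPart (![mulCochain A, f] 0) z x y = x * y := fun _ _ _ => rfl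
  have hb : ∀ z x y, binaryPart (![mulCochain A, f] 1) z x y = binaryPart f z x y :=
    fun _ _ _ => rfl
  have hum : ∀ x, unaryPart (![mulCochain A, f] 0) ψ x = 0 := fun _ => rfl
  have hu : ∀ x, unaryPart (![mulCochain A, f] 1) ψ x = unaryPart f ψ x := fun _ => rfl
  have hc0 : ∀ z x y, binaryPart ((Fin.cons (mulCochain A) (fun _ => f) :
      Fin 3 → TotCochain A) 0) z x y = x * y := fun _ _ _ => rfl
  have hc1 : ∀ x, unaryPart ((Fin.cons (mulCochain A) (fun _ => f) :
      Fin 3 → TotCochain A) 1) ψ x = unaryPart f ψ x := fun _ => rfl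
  have hc2 : ∀ x, unaryPart ((Fin.cons (mulCochain A) (fun _ => f) :
      Fin 3 → TotCochain A) 2) ψ x = unaryPart f ψ x := fun _ => rfl
  simp only [deformedMul_apply, deformedMap_apply]
  simp only [hm, hb, hum, hu, hc0, hc1, hc2, mul_add, add_mul, binaryPart_add_left,
    binaryPart_add_right, unaryPart_add, map_add, map_mul, rootSign_zero, rootSign_one, one_smul,
    neg_smul, binaryPart_zero_left, binaryPart_zero_right]
  abel

/-- The simplicial coboundary gives the terms linear in `g`, and the one-edge quilt gives `g g`. The
Hochschild coboundary vanishes here, since `m` has no component in (1,1); the terms without `g`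
cancel by functoriality of `A`. -/
theorem curvature_two_one (hf : IsDeformationCochain f) (φ : Simplex C 2)
    (a : Fin 1 → A.obj (φ.vertex 2)) :
    curvature f 2 1 φ a =
      deformedMap f (φ.arrow (by decide : (0 : Fin 3) ≤ 1))
        (deformedMap f (φ.arrow (by decide : (1 : Fin 3) ≤ 2)) (a 0)) -
      deformedMap f (φ.arrow (by decide : (0 : Fin 3) ≤ 2)) (a 0) := by
  have h1 := act_edgeQuilt_two_one (r := 0) (c := 1) (by decide)
    (isDeformationCochain_pair hf) φ a
  have h2 := act_edgeQuilt_two_one (r := 1) (c := 0) (by decide)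
    (isDeformationCochain_pair hf) φ a
  have h3 := act_edgeQuilt_two_one (r := 0) (c := 1) (by decide) (f := fun _ => f)
    (fun _ => hf) φ a
  have h4 : ∀ g : Fin 3 → TotCochain A, (∀ a, IsDeformationCochain (g a)) →
      cherryQuilt.act g 2 1 φ a = 0 := fun g hg => by
    rw [act_cherryQuilt_eq_zero hg 1 (by decide)]
    rfl
  rw [curvature_apply hf 2 1 φ a, deltaS_two_one, h1, h2, h3, h4 _ (isDeformationCochain_cons hf),
    h4 _ (fun _ => hf)]
  have hcomp : algMap A (φ.arrow (by decide : (0 : Fin 3) ≤ 2)) (a 0) =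
      algMap A (φ.arrow (by decide : (0 : Fin 3) ≤ 1))
        (algMap A (φ.arrow (by decide : (1 : Fin 3) ≤ 2)) (a 0)) := by
    rw [← algMap_comp]
    refine congrArg (fun g => algMap A g (a 0)) ?_
    rw [Simplex.arrow, Simplex.arrow, Simplex.arrow, ← unop_comp, ← φ.map_comp]
    rfl
  simp only [deformedMap_apply, hcomp]
  generalize a 0 = x
  have hum : ∀ {X Y : C} (ψ : X ⟶ Y) x, unaryPart (![mulCochain A, f] 0) ψ x = 0 :=
    fun _ _ => rfl
  have hu : ∀ {X Y : C} (ψ : X ⟶ Y) x, unaryPart (![mulCochain A, f] 1) ψ x = unaryPart f ψ x :=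
    fun _ _ => rfl
  have hz : ∀ {X Y : C} (ψ : X ⟶ Y), unaryPart f ψ 0 = 0 := fun ψ => by
    have := unaryPart_smul f ψ 0 0
    rwa [zero_smul, zero_smul] at this
  simp only [hum, hu, hz, unaryPart_add, map_add, rootSign_zero, rootSign_one, one_smul, neg_smul,
    add_zero]
  abel

/-- The Maurer-Cartan equation means that the deformed multiplications and maps form a diagram of
algebras, up to the condition on identities. -/
theorem isMaurerCartan_iff_deformed (hf : IsDeformationCochain f) : IsMaurerCartan f ↔
    (∀ (x : C) (a b c : A.obj x), deformedMul f x (deformedMul f x a b) c =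
      deformedMul f x a (deformedMul f x b c)) ∧
    (∀ (x y : C) (φ : x ⟶ y) (a b : A.obj x), deformedMap f φ (deformedMul f x a b) =
      deformedMul f y (deformedMap f φ a) (deformedMap f φ b)) ∧
    (∀ (x y z : C) (φ : x ⟶ y) (ψ : y ⟶ z) (a : A.obj x), deformedMap f (φ ≫ ψ) a =
      deformedMap f ψ (deformedMap f φ a)) := by
  rw [isMaurerCartan_iff hf]
  change curvature f = 0 ↔ _
  constructor
  · intro h
    refine ⟨fun x a b c => ?_, fun x y φ a b => ?_, fun x y z φ ψ a => ?_⟩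
    · have h1 := curvature_zero_three hf (Simplex.ofObj x) ![a, b, c]
      rw [h] at h1
      exact (sub_eq_zero.1 h1.symm).symm
    · have h1 := curvature_one_two hf (Simplex.ofHom φ) ![a, b]
      rw [h] at h1
      exact sub_eq_zero.1 h1.symm
    · have h1 := curvature_two_one hf (ComposableArrows.mk₂ ψ.op φ.op) ![a]
      rw [h] at h1
      exact (sub_eq_zero.1 h1.symm).symm
  · rintro ⟨h1, h2, h3⟩
    funext p' q'
    by_cases hpq : p' + q' ≠ 3 ∨ q' = 0
    · exact curvature_eq_zero hf hpq
    · obtain ⟨rfl, rfl⟩ | ⟨rfl, rfl⟩ | ⟨rfl, rfl⟩ :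
        (p' = 0 ∧ q' = 3) ∨ (p' = 1 ∧ q' = 2) ∨ (p' = 2 ∧ q' = 1) := by omega
      · funext φ a
        exact (curvature_zero_three hf φ a).trans (sub_eq_zero.2 (h1 _ _ _ _).symm)
      · funext φ a
        exact (curvature_one_two hf φ a).trans (sub_eq_zero.2 (h2 _ _ _ _ _))
      · funext φ a
        refine (curvature_two_one hf φ a).trans (sub_eq_zero.2 ?_)
        rw [← h3]
        refine congrArg (fun g => deformedMap f g (a 0)) ?_
        rw [Simplex.arrow, Simplex.arrow, Simplex.arrow, ← unop_comp, ← φ.map_comp]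
        rfl

end Deformation

/-! ### The bijection with deformations -/

section Bijection

variable {k : Type t} [Field k] {C : Type u} [Category.{v} C] {A : C ⥤ NUAlg.{t, w} k}

theorem isDeformationCochain_of_degree {f : TotCochain A} (h1 : HasShiftedDegree f 1)
    (h2 : IsAsimplicial f) : IsDeformationCochain f := by
  rintro p q (h | rfl)
  · exact h1 p q (by omega)
  · exact h2 p

theorem IsDeformationCochain.ext {f g : TotCochain A} (hf : IsDeformationCochain f)
    (hg : IsDeformationCochain g)
    (hb : ∀ (x : C) (a b : A.obj x), binaryPart f x a b = binaryPart g x a b)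
    (hu : ∀ (x y : C) (φ : x ⟶ y) (a : A.obj x), unaryPart f φ a = unaryPart g φ a) : f = g := by
  funext p q
  by_cases hpq : p + q ≠ 2 ∨ q = 0
  · rw [hf p q hpq, hg p q hpq]
  · obtain ⟨rfl, rfl⟩ | ⟨rfl, rfl⟩ : (p = 0 ∧ q = 2) ∨ (p = 1 ∧ q = 1) := by omega
    · funext φ
      ext v
      rw [binaryPart_vertex, binaryPart_vertex]
      exact hb _ _ _
    · funext φ
      ext v
      rw [unaryPart_arrow, unaryPart_arrow]
      exact hu _ _ _ _

theorem unaryPart_id {f : TotCochain A} (hf : IsNormalized f) (x : C) (a : A.obj x) :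
    unaryPart f (𝟙 x) a = 0 := by
  have h : (Simplex.ofHom (𝟙 x)).HasIdentity := ⟨0, rfl, rfl⟩
  rw [unaryPart, hf 1 1 _ h]
  rfl

/-- The diagram of algebras that is given by a solution of the Maurer-Cartan equation. -/
def deformationOf (f : TotCochain A) (hf : IsDeformationCochain f) (hn : IsNormalized f)
    (hmc : IsMaurerCartan f) : DiagramDeformation A where
  mul := deformedMul f
  map φ := deformedMap f φ
  mul_assoc := ((isMaurerCartan_iff_deformed hf).1 hmc).1
  map_mul φ := ((isMaurerCartan_iff_deformed hf).1 hmc).2.1 _ _ φ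
  map_id x := by
    ext a
    rw [deformedMap_apply, unaryPart_id hn, algMap_id, add_zero]
    rfl
  map_comp φ ψ := by
    ext a
    exact ((isMaurerCartan_iff_deformed hf).1 hmc).2.2 _ _ _ φ ψ a

/-- A bilinear map as a multilinear map. -/
def bilinearMultilinear {M N : Type*} [AddCommGroup M] [Module k M] [AddCommGroup N] [Module k N]
    (B : M →ₗ[k] M →ₗ[k] N) : MultilinearMap k (fun _ : Fin 2 => M) N where
  toFun a := B (a 0) (a 1)
  map_update_add' := by
    intro _ a i x y
    fin_cases i <;> simp
  map_update_smul' := by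
    intro _ a i c x
    fin_cases i <;> simp

/-- The bilinear part of the cochain that belongs to a deformation. -/
def mulDifference (D : DiagramDeformation A) : Cochain A 0 2 := fun φ =>
  bilinearMultilinear (D.mul (φ.vertex 0) - LinearMap.mul k (A.obj (φ.vertex 0)))

/-- The linear part of the cochain that belongs to a deformation. -/
def mapDifference (D : DiagramDeformation A) : Cochain A 1 1 := fun φ =>
  { toFun := fun a => (D.map (φ.arrow (Fin.zero_le (1 : Fin 2))) (a 0) -
      algMap A (φ.arrow (Fin.zero_le (1 : Fin 2))) (a 0) : A.obj (φ.vertex 0))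
    map_update_add' := by
      intro _ a i x y
      obtain rfl := Subsingleton.elim i 0
      simp only [Function.update_self]
      rw [map_add (D.map _), map_add (algMap A _)]
      abel
    map_update_smul' := by
      intro _ a i c x
      obtain rfl := Subsingleton.elim i 0
      simp only [Function.update_self]
      rw [map_smul (D.map _), map_smul (algMap A _), smul_sub] }

/-- The cochain that belongs to a deformation. -/
def cochainOf (D : DiagramDeformation A) : TotCochain A
  | 0, 2 => mulDifference D
  | 1, 1 => mapDifference D
  | _, _ => 0

theorem isDeformationCochain_cochainOf (D : DiagramDeformation A) :
    IsDeformationCochain (cochainOf D) := by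
  rintro (_ | _ | p) (_ | _ | _ | q) h
  all_goals first | rfl | omega

theorem deformedMul_cochainOf (D : DiagramDeformation A) (x : C) :
    deformedMul (cochainOf D) x = D.mul x := by
  ext a b
  exact add_sub_cancel (a * b) (D.mul x a b)

theorem deformedMap_cochainOf (D : DiagramDeformation A) {x y : C} (φ : x ⟶ y) :
    deformedMap (cochainOf D) φ = D.map φ := by
  ext a
  exact add_sub_cancel (algMap A φ a) (D.map φ a)

/-- An identity arrow in a simplex is known only up to an equality of its end points, hence the form
with `eqToHom`. -/
theorem DiagramDeformation.map_eqToHom (D : DiagramDeformation A) {x y : C} (h : x = y)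
    (a : A.obj x) : D.map (eqToHom h) a = algMap A (eqToHom h) a := by
  subst h
  rw [eqToHom_refl, D.map_id, algMap_id]
  rfl

theorem isNormalized_cochainOf (D : DiagramDeformation A) : IsNormalized (cochainOf D) := by
  intro p q φ hφ
  by_cases hpq : p + q ≠ 2 ∨ q = 0
  · rw [isDeformationCochain_cochainOf D p q hpq]
    rfl
  · obtain ⟨i, h, hi⟩ := hφ
    -- A 0-simplex has no arrows, so only the component in (1,1) needs a check.
    obtain ⟨rfl, rfl⟩ : p = 1 ∧ q = 1 := by
      have := i.2
      omega
    obtain rfl := Subsingleton.elim i 0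
    ext a
    refine sub_eq_zero.2 ?_
    have key : ∀ ψ : φ.vertex 1 ⟶ φ.vertex 0, ψ = eqToHom h → ∀ b : A.obj (φ.vertex 1),
        D.map ψ b = algMap A ψ b := by
      rintro _ rfl b
      exact D.map_eqToHom h b
    exact key _ hi _

theorem isMaurerCartan_cochainOf (D : DiagramDeformation A) : IsMaurerCartan (cochainOf D) := by
  rw [isMaurerCartan_iff_deformed (isDeformationCochain_cochainOf D)]
  simp only [deformedMul_cochainOf, deformedMap_cochainOf]
  refine ⟨D.mul_assoc, fun _ _ φ => D.map_mul φ, fun _ _ _ φ ψ a => ?_⟩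
  rw [D.map_comp]
  rfl

end Bijection

end HochschildMC

theorem mainTheorem6 {k : Type*} [Field k] {C : Type*} [CategoryTheory.Category C]
    (A : C ⥤ HochschildMC.NUAlg k) :
    ∃ e : {f : HochschildMC.TotCochain A // HochschildMC.HasShiftedDegree f 1 ∧
          HochschildMC.IsAsimplicial f ∧ HochschildMC.IsNormalized f ∧
          HochschildMC.IsMaurerCartan f} ≃ HochschildMC.DiagramDeformation A,
      ∀ f,
        (∀ (x : C) (a b : A.obj x),
          (e f).mul x a b = a * b + HochschildMC.binaryPart f.1 x a b) ∧
        (∀ (x y : C) (φ : x ⟶ y) (a : A.obj x),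
          (e f).map φ a = HochschildMC.algMap A φ a + HochschildMC.unaryPart f.1 φ a) := by
  have hdef : ∀ f : {f : HochschildMC.TotCochain A // HochschildMC.HasShiftedDegree f 1 ∧
      HochschildMC.IsAsimplicial f ∧ HochschildMC.IsNormalized f ∧
      HochschildMC.IsMaurerCartan f}, HochschildMC.IsDeformationCochain f.1 := fun f =>
    HochschildMC.isDeformationCochain_of_degree f.2.1 f.2.2.1
  refine ⟨Equiv.ofBijective (fun f => HochschildMC.deformationOf f.1 (hdef f) f.2.2.2.1 f.2.2.2.2)
    ⟨fun f g hfg => ?_, fun D => ?_⟩, fun f => ⟨fun _ _ _ => rfl, fun _ _ _ _ => rfl⟩⟩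
  · refine Subtype.ext ((hdef f).ext (hdef g) (fun x a b => ?_) fun x y φ a => ?_)
    · exact add_left_cancel (congrArg (fun D : HochschildMC.DiagramDeformation A =>
        D.mul x a b) hfg)
    · exact add_left_cancel (congrArg (fun D : HochschildMC.DiagramDeformation A =>
        D.map φ a) hfg)
  · have hD := HochschildMC.isDeformationCochain_cochainOf D
    refine ⟨⟨HochschildMC.cochainOf D, fun p q hpq => hD p q (Or.inl (by omega)),
      fun p => hD p 0 (Or.inr rfl), HochschildMC.isNormalized_cochainOf D,
      HochschildMC.isMaurerCartan_cochainOf D⟩, HochschildMC.DiagramDeformation.ext ?_ ?_⟩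
    · funext x
      exact HochschildMC.deformedMul_cochainOf D x
    · funext x y φ
      exact HochschildMC.deformedMap_cochainOf D φ
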